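/- Let $N\in\mathbb N$ and let $\omega:[0,\infty)\to[0,\infty)$ be a non-quasianalytic weight function, i.e. $\omega$ is continuous and increasing (in the weak sense) and ($\alpha$) there is $K\ge 1$ with $\omega(2t)\le K(1+\omega(t))$ for all $t\ge0$; ($\beta$) $\int_1^\infty \frac{\omega(t)}{1+t^2}\,dt<\infty$; ($\gamma$) there are $a\in\mathbb R$, $b>0$ with $\omega(t)\ge a+b\log(1+t)$ for all $t\ge0$; ($\delta$) $t\mapsto\omega(e^t)$ is convex on $\mathbb R$. Write $\omega(x):=\omega(|x|)$ for $x\in\mathbb R^N$, and let $\varphi^*(s):=\sup_{t\ge0}\{st-\omega(e^t)\}\in(-\infty,+\infty]$ for $s\ge0$, with the convention $\exp(-\infty)=0$. All functions are complex-valued, $\alpha$ ranges over $\mathbb N_0^N$, and $m,n$ range over the positive integers. (a) $\mathcal E_\omega(\mathbb R^N)$ is the space of all $f\in C^\infty(\mathbb R^N)$ with $p_{K,m}(f):=\sup_{x\in K}\sup_\alpha|\partial^\alpha f(x)|\exp(-m\varphi^*(|\alpha|/m))<\infty$ for all compact $K\subset\mathbb R^N$ and all $m$, with the topology given by the seminorms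 $p_{K,m}$; $\mathcal D_\omega(\mathbb R^N)$ is the space of all $f\in\mathcal E_\omega(\mathbb R^N)$ with compact support. (b) $\mathcal S_\omega(\mathbb R^N)$ is the space of all $f\in L^1(\mathbb R^N)$ such that $f,\hat f\in C^\infty(\mathbb R^N)$ and $\|e^{\lambda\omega}\partial^\alpha f\|_\infty<\infty$, $\|e^{\lambda\omega}\partial^\alpha\hat f\|_\infty<\infty$ for all $\lambda>0$ and all $\alpha$, where $\hat f(\xi)=\int f(x)e^{-ix\cdot\xi}\,dx$; its topology is given by the norms $\|e^{n\omega}\partial^\alpha f\|_\infty+\|e^{n\omega}\partial^\alpha\hat f\|_\infty$. (c) $\mathcal O^m_{n,\omega}(\mathbb R^N)$ is the space of all $f\in C^\infty(\mathbb R^N)$ with $r_{m,n}(f):=\sup_{\alpha}\sup_{x\in\mathbb R^N}|\partial^\alpha f(x)|\exp(-n\omega(x)-m\varphi^*(|\alpha|/m))<\infty$, normed by $r_{m,n}$. Then $\mathcal O_{C,\omega}(\mathbb R^N):=\bigcup_n\bigcap_m\mathcal O^m_{n,\omega}(\mathbb R^N)$ carries the locally convex inductive limit topology of the spaces $\bigcap_m\mathcal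 O^m_{n,\omega}(\mathbb R^N)$, $n\ge1$, each with the topology given by the norms $r_{m,n}$, $m\ge1$. The space $\mathcal O_{M,\omega}(\mathbb R^N):=\bigcap_m\bigcup_n\mathcal O^m_{n,\omega}(\mathbb R^N)$ carries the projective limit topology of the spaces $\bigcup_n\mathcal O^m_{n,\omega}(\mathbb R^N)$, $m\ge1$, each with the locally convex inductive limit topology of the normed spaces $(\mathcal O^m_{n,\omega}(\mathbb R^N),r_{m,n})$, $n\ge1$. Theorem. One has $$\mathcal D_\omega(\mathbb R^N)\subset\mathcal S_\omega(\mathbb R^N)\subset\mathcal O_{C,\omega}(\mathbb R^N)\subset\mathcal O_{M,\omega}(\mathbb R^N)\subset\mathcal E_\omega(\mathbb R^N),$$ and each of these spaces is dense in the next one with respect to the topology of the latter. -/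

import Mathlib

noncomputable section

namespace BeurlingSpaces

open scoped ENNReal

/-- A non-quasianalytic weight function `ω : [0,∞) → [0,∞)`. Only the values on `[0,∞)` matter;
the logarithm `t ↦ log (1 + t)` is admitted. -/
structure Weight where
  toFun : ℝ → ℝ
  nonneg : ∀ t, 0 ≤ t → 0 ≤ toFun t
  continuousOn : ContinuousOn toFun (Set.Ici 0)
  monotoneOn : MonotoneOn toFun (Set.Ici 0)
  doubling : ∃ K : ℝ, 1 ≤ K ∧ ∀ t, 0 ≤ t → toFun (2 * t) ≤ K * (1 + toFun t)
  integrable : MeasureTheory.IntegrableOn (fun t : ℝ => toFun t / (1 + t ^ 2)) (Set.Ici 1)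
  log_le : ∃ a b : ℝ, 0 < b ∧ ∀ t, 0 ≤ t → a + b * Real.log (1 + t) ≤ toFun t
  convex : ConvexOn ℝ Set.univ (fun t : ℝ => toFun (Real.exp t))

instance : CoeFun Weight (fun _ => ℝ → ℝ) := ⟨Weight.toFun⟩

/-- The Young conjugate `φ*(s) = sup_{t ≥ 0} (s t - ω(exp t))`. It takes the value `⊤` for large
`s` when `ω` grows like a logarithm, hence it is `EReal`-valued. -/
def youngConj (ω : Weight) (s : ℝ) : EReal :=
  ⨆ (t : ℝ) (_ : 0 ≤ t), ((s * t - ω (Real.exp t) : ℝ) : EReal)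

abbrev Rn (N : ℕ) : Type := EuclideanSpace ℝ (Fin N)

abbrev MultiIndex (N : ℕ) : Type := Fin N → ℕ

/-- `|α| = α₁ + ⋯ + α_N`. -/
def MultiIndex.order {N : ℕ} (α : MultiIndex N) : ℕ := ∑ i, α i

/-- The partial derivative `∂ᵢ f`. -/
def pderiv {N : ℕ} (i : Fin N) (f : Rn N → ℂ) : Rn N → ℂ :=
  fun x => fderiv ℝ f x (EuclideanSpace.single i 1)

/-- The partial derivative `∂^α f = ∂₁^{α₁} ⋯ ∂_N^{α_N} f`. -/
def mderiv {N : ℕ} (α : MultiIndex N) (f : Rn N → ℂ) : Rn N → ℂ :=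
  (List.finRange N).foldr (fun i g => (pderiv i)^[α i] g) f

/-- The space `C^∞(ℝ^N)` of complex-valued smooth functions. -/
def Smooth (N : ℕ) : Submodule ℂ (Rn N → ℂ) where
  carrier := {f | ContDiff ℝ ((⊤ : ℕ∞) : WithTop ℕ∞) f}
  add_mem' hf hg := Set.mem_ofPred.2 (ContDiff.add (Set.mem_ofPred.1 hf) (Set.mem_ofPred.1 hg))
  zero_mem' := Set.mem_ofPred.2 contDiff_zero_fun
  smul_mem' c _ hf := Set.mem_ofPred.2 (ContDiff.const_smul c (Set.mem_ofPred.1 hf))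

theorem pderiv_mem {N : ℕ} (i : Fin N) {f : Rn N → ℂ} (hf : f ∈ Smooth N) :
    pderiv i f ∈ Smooth N := by
  have h : ContDiff ℝ ((⊤ : ℕ∞) : WithTop ℕ∞) f := hf
  exact (h.fderiv_right (m := ((⊤ : ℕ∞) : WithTop ℕ∞)) (by simp)).clm_apply contDiff_const

theorem pderiv_add {N : ℕ} (i : Fin N) {f g : Rn N → ℂ} (hf : f ∈ Smooth N)
    (hg : g ∈ Smooth N) : pderiv i (f + g) = pderiv i f + pderiv i g := by
  have h : ContDiff ℝ ((⊤ : ℕ∞) : WithTop ℕ∞) f := hf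
  have h' : ContDiff ℝ ((⊤ : ℕ∞) : WithTop ℕ∞) g := hg
  ext x
  simp only [pderiv, Pi.add_apply]
  rw [fderiv_add (h.differentiable (by simp) x) (h'.differentiable (by simp) x)]
  rfl

theorem pderiv_smul {N : ℕ} (i : Fin N) (c : ℂ) {f : Rn N → ℂ} (hf : f ∈ Smooth N) :
    pderiv i (c • f) = c • pderiv i f := by
  have h : ContDiff ℝ ((⊤ : ℕ∞) : WithTop ℕ∞) f := hf
  ext x
  simp only [pderiv, Pi.smul_apply]
  rw [fderiv_const_smul (h.differentiable (by simp) x)]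
  rfl

theorem iter_pderiv {N : ℕ} (i : Fin N) (k : ℕ) :
    (∀ f ∈ Smooth N, (pderiv i)^[k] f ∈ Smooth N) ∧
    (∀ f ∈ Smooth N, ∀ g ∈ Smooth N,
      (pderiv i)^[k] (f + g) = (pderiv i)^[k] f + (pderiv i)^[k] g) ∧
    (∀ c : ℂ, ∀ f ∈ Smooth N, (pderiv i)^[k] (c • f) = c • (pderiv i)^[k] f) := by
  induction k with
  | zero => simp
  | succ k ih =>
    obtain ⟨h1, h2, h3⟩ := ih
    simp only [Function.iterate_succ_apply']
    refine ⟨fun f hf => pderiv_mem i (h1 f hf), fun f hf g hg => ?_, fun c f hf => ?_⟩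
    · rw [h2 f hf g hg, pderiv_add i (h1 f hf) (h1 g hg)]
    · rw [h3 c f hf, pderiv_smul i c (h1 f hf)]

theorem mderiv_aux {N : ℕ} (α : MultiIndex N) (l : List (Fin N)) :
    (∀ f ∈ Smooth N, l.foldr (fun i g => (pderiv i)^[α i] g) f ∈ Smooth N) ∧
    (∀ f ∈ Smooth N, ∀ g ∈ Smooth N, l.foldr (fun i g => (pderiv i)^[α i] g) (f + g) =
      l.foldr (fun i g => (pderiv i)^[α i] g) f + l.foldr (fun i g => (pderiv i)^[α i] g) g) ∧
    (∀ c : ℂ, ∀ f ∈ Smooth N, l.foldr (fun i g => (pderiv i)^[α i] g) (c • f) =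
      c • l.foldr (fun i g => (pderiv i)^[α i] g) f) := by
  induction l with
  | nil => simp
  | cons i l ih =>
    obtain ⟨h1, h2, h3⟩ := ih
    obtain ⟨k1, k2, k3⟩ := iter_pderiv i (α i)
    simp only [List.foldr_cons]
    refine ⟨fun f hf => k1 _ (h1 f hf), fun f hf g hg => ?_, fun c f hf => ?_⟩
    · rw [h2 f hf g hg, k2 _ (h1 f hf) _ (h1 g hg)]
    · rw [h3 c f hf, k3 c _ (h1 f hf)]

theorem mderiv_add {N : ℕ} (α : MultiIndex N) {f g : Rn N → ℂ} (hf : f ∈ Smooth N)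
    (hg : g ∈ Smooth N) : mderiv α (f + g) = mderiv α f + mderiv α g :=
  (mderiv_aux α _).2.1 f hf g hg

theorem mderiv_smul {N : ℕ} (α : MultiIndex N) (c : ℂ) {f : Rn N → ℂ} (hf : f ∈ Smooth N) :
    mderiv α (c • f) = c • mderiv α f :=
  (mderiv_aux α _).2.2 c f hf

/-- The weighted supremum `sup_i |u i| c i` in `[0,∞]`. -/
def wsup {ι : Type*} (c : ι → ℝ≥0∞) (u : ι → ℂ) : ℝ≥0∞ := ⨆ i, ‖u i‖ₑ * c i

theorem wsup_add_le {ι : Type*} (c : ι → ℝ≥0∞) (u v : ι → ℂ) :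
    wsup c (u + v) ≤ wsup c u + wsup c v := by
  refine iSup_le fun i => ?_
  calc ‖u i + v i‖ₑ * c i ≤ (‖u i‖ₑ + ‖v i‖ₑ) * c i := by gcongr; exact enorm_add_le _ _
    _ = ‖u i‖ₑ * c i + ‖v i‖ₑ * c i := add_mul _ _ _
    _ ≤ _ := add_le_add (le_iSup (fun i => ‖u i‖ₑ * c i) i) (le_iSup (fun i => ‖v i‖ₑ * c i) i)

theorem wsup_smul {ι : Type*} (c : ι → ℝ≥0∞) (a : ℂ) (u : ι → ℂ) :
    wsup c (a • u) = ‖a‖ₑ * wsup c u := by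
  simp only [wsup, Pi.smul_apply, ENNReal.mul_iSup, smul_eq_mul, enorm_mul, mul_assoc]

theorem wsup_zero {ι : Type*} (c : ι → ℝ≥0∞) : wsup c (0 : ι → ℂ) = 0 := by
  simp [wsup]

/-- A weighted supremum of a linear family of functions, finite on the whole space `V`, as a
seminorm on `V`. -/
def wsupSeminorm {V ι : Type*} [AddCommGroup V] [Module ℂ V] (c : ι → ℝ≥0∞)
    (L : V → ι → ℂ) (hadd : ∀ f g, L (f + g) = L f + L g) (hsmul : ∀ (a : ℂ) f, L (a • f) = a • L f)
    (hfin : ∀ f, wsup c (L f) < ∞) : Seminorm ℂ V :=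
  Seminorm.of (fun f => (wsup c (L f)).toReal)
    (fun f g => by
      rw [hadd, ← ENNReal.toReal_add (hfin f).ne (hfin g).ne]
      exact ENNReal.toReal_mono (ENNReal.add_lt_top.2 ⟨hfin f, hfin g⟩).ne (wsup_add_le _ _ _))
    (fun a f => by simp [hsmul, wsup_smul])

/-- The locally convex topology generated by a family of seminorms. -/
@[reducible] def seminormTopology {V ι : Type*} [AddCommGroup V] [Module ℂ V] [Nonempty ι]
    (p : SeminormFamily ℂ V ι) : TopologicalSpace V :=
  p.moduleFilterBasis.topology

/-- The locally convex inductive limit topology on `V` for the subspaces `W i ⊆ V`: the finest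
locally convex vector space topology on `V` that makes all inclusions `W i → V` continuous. -/
@[reducible] def inductiveTopology {X ι : Type*} [AddCommGroup X] [Module ℂ X] [Module ℝ X]
    [IsScalarTower ℝ ℂ X]
    (V : Submodule ℂ X) (W : ι → Submodule ℂ X) (hW : ∀ i, W i ≤ V)
    (tW : ∀ i, TopologicalSpace (W i)) : TopologicalSpace V :=
  sInf {t : TopologicalSpace V |
    @IsTopologicalAddGroup V t _ ∧
    @ContinuousSMul ℂ V _ _ t ∧
    @LocallyConvexSpace ℝ V _ _ _ _ t ∧
    ∀ i, @Continuous (W i) V (tW i) t (Submodule.inclusion (hW i))}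

/-- The weight `exp(-n ω(x) - m φ*(|α|/m))`; it is `0` where `φ*(|α|/m) = ⊤`. -/
def rWeight (ω : Weight) (N : ℕ) (m : ℕ+) (n : ℤ) : MultiIndex N × Rn N → ℝ≥0∞ :=
  fun q => EReal.exp (-((n * ω ‖q.2‖ : ℝ) : EReal)
    - ((m : ℝ) : EReal) * youngConj ω ((q.1.order : ℝ) / (m : ℝ)))

/-- `r_{m,n}(f) = sup_{α, x} |∂^α f(x)| exp(-n ω(x) - m φ*(|α|/m))`, in `[0,∞]`. -/
def r (ω : Weight) {N : ℕ} (m : ℕ+) (n : ℤ) (f : Rn N → ℂ) : ℝ≥0∞ :=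
  wsup (rWeight ω N m n) (fun q => mderiv q.1 f q.2)

/-- The Banach space `O^m_{n,ω}(ℝ^N)` of smooth functions with `r_{m,n}(f) < ∞`. -/
def O (ω : Weight) (N : ℕ) (m : ℕ+) (n : ℤ) : Submodule ℂ (Rn N → ℂ) where
  carrier := {f | f ∈ Smooth N ∧ r ω m n f < ∞}
  add_mem' := by
    rintro f g ⟨hf, hf'⟩ ⟨hg, hg'⟩
    refine ⟨add_mem hf hg, lt_of_le_of_lt ?_ (ENNReal.add_lt_top.2 ⟨hf', hg'⟩)⟩
    simp only [r, mderiv_add _ hf hg]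
    exact wsup_add_le _ _ _
  zero_mem' := by
    refine ⟨zero_mem _, ?_⟩
    have h : ∀ α : MultiIndex N, mderiv α (0 : Rn N → ℂ) = 0 := fun α => by
      simpa using mderiv_smul α 0 (zero_mem (Smooth N))
    simp [r, h, wsup]
  smul_mem' := by
    rintro c f ⟨hf, hf'⟩
    refine ⟨Submodule.smul_mem _ c hf, ?_⟩
    simp only [r, mderiv_smul _ c hf]
    have := wsup_smul (rWeight ω N m n) c (fun q => mderiv q.1 f q.2)
    exact lt_of_eq_of_lt this (ENNReal.mul_lt_top (by simp) hf')

theorem O_mono (ω : Weight) (N : ℕ) (m : ℕ+) {n n' : ℤ} (h : n ≤ n') :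
    O ω N m n ≤ O ω N m n' := by
  rintro f ⟨hf, hf'⟩
  refine ⟨hf, lt_of_le_of_lt (iSup_mono fun q => ?_) hf'⟩
  refine mul_le_mul_right (EReal.exp_monotone ?_) _
  refine EReal.sub_le_sub (EReal.neg_le_neg_iff.2 ?_) le_rfl
  have h1 := ω.nonneg ‖q.2‖ (norm_nonneg _)
  have h2 : (n : ℝ) ≤ n' := by exact_mod_cast h
  exact_mod_cast mul_le_mul_of_nonneg_right h2 h1

/-- `r_{m,n}` as a seminorm on a subspace of `O^m_{n,ω}(ℝ^N)`. -/
def rSeminorm (ω : Weight) (N : ℕ) (m : ℕ+) (n : ℤ) (W : Submodule ℂ (Rn N → ℂ))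
    (hW : W ≤ O ω N m n) : Seminorm ℂ W :=
  wsupSeminorm (rWeight ω N m n) (fun f q => mderiv q.1 (f : Rn N → ℂ) q.2)
    (fun f g => by simp only [Submodule.coe_add, mderiv_add _ (hW f.2).1 (hW g.2).1]; rfl)
    (fun a f => by simp only [Submodule.coe_smul, mderiv_smul _ a (hW f.2).1]; rfl)
    (fun f => (hW f.2).2)

/-- The topology of the Banach space `O^m_{n,ω}(ℝ^N)`. -/
@[reducible] def topO (ω : Weight) (N : ℕ) (m : ℕ+) (n : ℤ) : TopologicalSpace (O ω N m n) :=
  seminormTopology (fun _ : Unit => rSeminorm ω N m n _ le_rfl)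

/-- The union of the increasing sequence `O^m_{n,ω}(ℝ^N)`, `n ∈ ℕ`, for fixed `m`. -/
def OUnion (ω : Weight) (N : ℕ) (m : ℕ+) : Submodule ℂ (Rn N → ℂ) where
  carrier := ⋃ n : ℕ+, (O ω N m n : Set (Rn N → ℂ))
  add_mem' := by
    intro f g hf hg
    obtain ⟨n, hn⟩ := Set.mem_iUnion.1 hf
    obtain ⟨k, hk⟩ := Set.mem_iUnion.1 hg
    refine Set.mem_iUnion.2 ⟨n + k, add_mem (O_mono ω N m ?_ hn) (O_mono ω N m ?_ hk)⟩ <;>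
    · push_cast
      simp
  zero_mem' := Set.mem_iUnion.2 ⟨1, zero_mem _⟩
  smul_mem' := by
    intro c f hf
    obtain ⟨n, hn⟩ := Set.mem_iUnion.1 hf
    exact Set.mem_iUnion.2 ⟨n, Submodule.smul_mem _ c hn⟩

theorem O_le_OUnion (ω : Weight) (N : ℕ) (m n : ℕ+) : O ω N m n ≤ OUnion ω N m :=
  fun _ hf => Set.mem_iUnion.2 ⟨n, hf⟩

/-- The (LB)-topology on `⋃_n O^m_{n,ω}(ℝ^N)`. -/
@[reducible] def topOUnion (ω : Weight) (N : ℕ) (m : ℕ+) : TopologicalSpace (OUnion ω N m) :=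
  inductiveTopology (OUnion ω N m) (fun n : ℕ+ => O ω N m n) (fun n => O_le_OUnion ω N m n)
    (fun n => topO ω N m n)

/-- The space `O_{M,ω}(ℝ^N) = ⋂_m ⋃_n O^m_{n,ω}(ℝ^N)` of slowly increasing functions. -/
def OM (ω : Weight) (N : ℕ) : Submodule ℂ (Rn N → ℂ) := ⨅ m : ℕ+, OUnion ω N m

theorem OM_le (ω : Weight) (N : ℕ) (m : ℕ+) : OM ω N ≤ OUnion ω N m := iInf_le _ m

/-- The projective limit topology on `O_{M,ω}(ℝ^N)` for the (LB)-spaces `⋃_n O^m_{n,ω}(ℝ^N)`. -/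
@[reducible] def topOM (ω : Weight) (N : ℕ) : TopologicalSpace (OM ω N) :=
  ⨅ m : ℕ+, (topOUnion ω N m).induced (Submodule.inclusion (OM_le ω N m))

/-- The Fréchet space `⋂_m O^m_{n,ω}(ℝ^N)` for fixed `n`. -/
def OInter (ω : Weight) (N : ℕ) (n : ℤ) : Submodule ℂ (Rn N → ℂ) := ⨅ m : ℕ+, O ω N m n

theorem OInter_le (ω : Weight) (N : ℕ) (n : ℤ) (m : ℕ+) : OInter ω N n ≤ O ω N m n := iInf_le _ m

/-- The Fréchet topology of `⋂_m O^m_{n,ω}(ℝ^N)`, given by the norms `r_{m,n}`, `m ∈ ℕ`. -/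
@[reducible] def topOInter (ω : Weight) (N : ℕ) (n : ℤ) : TopologicalSpace (OInter ω N n) :=
  seminormTopology (fun m : ℕ+ => rSeminorm ω N m n _ (OInter_le ω N n m))

theorem OInter_mono (ω : Weight) (N : ℕ) {n n' : ℤ} (h : n ≤ n') :
    OInter ω N n ≤ OInter ω N n' :=
  iInf_mono fun m => O_mono ω N m h

/-- The space `O_{C,ω}(ℝ^N) = ⋃_n ⋂_m O^m_{n,ω}(ℝ^N)` of very slowly increasing functions. -/
def OC (ω : Weight) (N : ℕ) : Submodule ℂ (Rn N → ℂ) where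
  carrier := ⋃ n : ℕ+, (OInter ω N n : Set (Rn N → ℂ))
  add_mem' := by
    intro f g hf hg
    obtain ⟨n, hn⟩ := Set.mem_iUnion.1 hf
    obtain ⟨k, hk⟩ := Set.mem_iUnion.1 hg
    refine Set.mem_iUnion.2 ⟨n + k, add_mem (OInter_mono ω N ?_ hn) (OInter_mono ω N ?_ hk)⟩ <;>
    · push_cast
      simp
  zero_mem' := Set.mem_iUnion.2 ⟨1, zero_mem _⟩
  smul_mem' := by
    intro c f hf
    obtain ⟨n, hn⟩ := Set.mem_iUnion.1 hf
    exact Set.mem_iUnion.2 ⟨n, Submodule.smul_mem _ c hn⟩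

theorem OInter_le_OC (ω : Weight) (N : ℕ) (n : ℕ+) : OInter ω N n ≤ OC ω N :=
  fun _ hf => Set.mem_iUnion.2 ⟨n, hf⟩

/-- The (LF)-topology on `O_{C,ω}(ℝ^N)`. -/
@[reducible] def topOC (ω : Weight) (N : ℕ) : TopologicalSpace (OC ω N) :=
  inductiveTopology (OC ω N) (fun n : ℕ+ => OInter ω N n) (fun n => OInter_le_OC ω N n)
    (fun n => topOInter ω N n)

/-- The weight `exp(-m φ*(|α|/m))`; it is `0` where `φ*(|α|/m) = ⊤`. -/
def pWeight (ω : Weight) {N : ℕ} (K : TopologicalSpace.Compacts (Rn N)) (m : ℕ+) :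
    MultiIndex N × K → ℝ≥0∞ :=
  fun q => EReal.exp (-(((m : ℝ) : EReal) * youngConj ω ((q.1.order : ℝ) / (m : ℝ))))

/-- `p_{K,m}(f) = sup_{α, x ∈ K} |∂^α f(x)| exp(-m φ*(|α|/m))`, in `[0,∞]`. -/
def p (ω : Weight) {N : ℕ} (K : TopologicalSpace.Compacts (Rn N)) (m : ℕ+) (f : Rn N → ℂ) :
    ℝ≥0∞ :=
  wsup (pWeight ω K m) (fun q => mderiv q.1 f q.2)

/-- The space `E_ω(ℝ^N)` of `ω`-ultradifferentiable functions of Beurling type. -/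
def E (ω : Weight) (N : ℕ) : Submodule ℂ (Rn N → ℂ) where
  carrier := {f | f ∈ Smooth N ∧ ∀ K m, p ω K m f < ∞}
  add_mem' := by
    rintro f g ⟨hf, hf'⟩ ⟨hg, hg'⟩
    refine ⟨add_mem hf hg, fun K m =>
      lt_of_le_of_lt ?_ (ENNReal.add_lt_top.2 ⟨hf' K m, hg' K m⟩)⟩
    simp only [p, mderiv_add _ hf hg]
    exact wsup_add_le _ _ _
  zero_mem' := by
    refine ⟨zero_mem _, fun K m => ?_⟩
    have h : ∀ α : MultiIndex N, mderiv α (0 : Rn N → ℂ) = 0 := fun α => by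
      simpa using mderiv_smul α 0 (zero_mem (Smooth N))
    simp [p, h, wsup]
  smul_mem' := by
    rintro c f ⟨hf, hf'⟩
    refine ⟨Submodule.smul_mem _ c hf, fun K m => ?_⟩
    simp only [p, mderiv_smul _ c hf]
    have := wsup_smul (pWeight ω K m) c (fun q => mderiv q.1 f q.2)
    exact lt_of_eq_of_lt this (ENNReal.mul_lt_top (by simp) (hf' K m))

/-- The Fréchet topology of `E_ω(ℝ^N)`, given by the seminorms `p_{K,m}`. -/
@[reducible] def topE (ω : Weight) (N : ℕ) : TopologicalSpace (E ω N) :=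
  seminormTopology (ι := TopologicalSpace.Compacts (Rn N) × ℕ+) fun k =>
    wsupSeminorm (pWeight ω k.1 k.2) (fun f q => mderiv q.1 (f : Rn N → ℂ) q.2)
      (fun f g => by simp only [Submodule.coe_add, mderiv_add _ f.2.1 g.2.1]; rfl)
      (fun a f => by simp only [Submodule.coe_smul, mderiv_smul _ a f.2.1]; rfl)
      (fun f => f.2.2 k.1 k.2)

/-- The space `D_ω(ℝ^N)` of test functions of Beurling type: the elements of `E_ω(ℝ^N)` with
compact support. -/
def D (ω : Weight) (N : ℕ) : Submodule ℂ (Rn N → ℂ) where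
  carrier := {f | f ∈ E ω N ∧ HasCompactSupport f}
  add_mem' hf hg := ⟨add_mem hf.1 hg.1, hf.2.add hg.2⟩
  zero_mem' := ⟨zero_mem _, HasCompactSupport.zero⟩
  smul_mem' c _ hf := ⟨Submodule.smul_mem _ c hf.1, hf.2.smul_left (f := fun _ => c)⟩

/-- The Fourier transform `∫ f(x) exp(-i x·ξ) dx`. -/
def fourier {N : ℕ} (f : Rn N → ℂ) : Rn N → ℂ :=
  fun ξ => ∫ x, f x * Complex.exp (-Complex.I * (inner ℝ x ξ : ℝ))

theorem fourier_integrable {N : ℕ} {f : Rn N → ℂ} (hf : MeasureTheory.Integrable f) (ξ : Rn N) :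
    MeasureTheory.Integrable (fun x => f x * Complex.exp (-Complex.I * (inner ℝ x ξ : ℝ))) := by
  refine hf.mul_bdd (c := 1) (Continuous.aestronglyMeasurable (by fun_prop)) ?_
  refine Filter.Eventually.of_forall fun x => le_of_eq ?_
  rw [Complex.norm_exp]
  simp

theorem fourier_add {N : ℕ} {f g : Rn N → ℂ} (hf : MeasureTheory.Integrable f)
    (hg : MeasureTheory.Integrable g) : fourier (f + g) = fourier f + fourier g := by
  ext ξ
  simp only [fourier, Pi.add_apply, add_mul]
  exact MeasureTheory.integral_add (fourier_integrable hf ξ) (fourier_integrable hg ξ)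

theorem fourier_smul {N : ℕ} (c : ℂ) (f : Rn N → ℂ) : fourier (c • f) = c • fourier f := by
  ext ξ
  simp only [fourier, Pi.smul_apply, smul_eq_mul, mul_assoc]
  exact MeasureTheory.integral_const_mul _ _

/-- `‖exp(lam ω) ∂^α f‖_∞`. -/
def s (ω : Weight) {N : ℕ} (lam : ℝ) (α : MultiIndex N) (f : Rn N → ℂ) : ℝ≥0∞ :=
  wsup (fun x : Rn N => ENNReal.ofReal (Real.exp (lam * ω ‖x‖))) (mderiv α f)

/-- The space `S_ω(ℝ^N)` of `ω`-ultradifferentiable rapidly decreasing functions. -/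
def S (ω : Weight) (N : ℕ) : Submodule ℂ (Rn N → ℂ) where
  carrier := {f | MeasureTheory.Integrable f ∧ f ∈ Smooth N ∧ fourier f ∈ Smooth N ∧
    ∀ (lam : ℝ) (α : MultiIndex N), 0 < lam → s ω lam α f < ∞ ∧ s ω lam α (fourier f) < ∞}
  add_mem' := by
    rintro f g ⟨hf1, hf2, hf3, hf4⟩ ⟨hg1, hg2, hg3, hg4⟩
    have h := fourier_add hf1 hg1
    refine ⟨hf1.add hg1, add_mem hf2 hg2, h ▸ add_mem hf3 hg3, fun lam α hl => ⟨?_, ?_⟩⟩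
    · rw [s, mderiv_add _ hf2 hg2]
      exact lt_of_le_of_lt (wsup_add_le _ _ _)
        (ENNReal.add_lt_top.2 ⟨(hf4 lam α hl).1, (hg4 lam α hl).1⟩)
    · rw [s, h, mderiv_add _ hf3 hg3]
      exact lt_of_le_of_lt (wsup_add_le _ _ _)
        (ENNReal.add_lt_top.2 ⟨(hf4 lam α hl).2, (hg4 lam α hl).2⟩)
  zero_mem' := by
    have h0 : fourier (0 : Rn N → ℂ) = 0 := by simpa using fourier_smul 0 (0 : Rn N → ℂ)
    have h : ∀ α : MultiIndex N, mderiv α (0 : Rn N → ℂ) = 0 := fun α => by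
      simpa using mderiv_smul α 0 (zero_mem (Smooth N))
    refine ⟨MeasureTheory.integrable_zero _ _ _, zero_mem _, by rw [h0]; exact zero_mem _,
      fun lam α _ => ?_⟩
    rw [h0, s, h, wsup_zero]
    simp
  smul_mem' := by
    rintro c f ⟨hf1, hf2, hf3, hf4⟩
    have h := fourier_smul c f
    refine ⟨hf1.smul c, Submodule.smul_mem _ c hf2, h ▸ Submodule.smul_mem _ c hf3,
      fun lam α hl => ⟨?_, ?_⟩⟩
    · rw [s, mderiv_smul _ c hf2, wsup_smul]
      exact ENNReal.mul_lt_top (by simp) (hf4 lam α hl).1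
    · rw [s, h, mderiv_smul _ c hf3, wsup_smul]
      exact ENNReal.mul_lt_top (by simp) (hf4 lam α hl).2

/-- The Fréchet topology of `S_ω(ℝ^N)`, given by the norms
`‖exp(n ω) ∂^α f‖_∞ + ‖exp(n ω) ∂^α (fourier f)‖_∞` with `n ∈ ℕ` and `α` a multi-index. -/
@[reducible] def topS (ω : Weight) (N : ℕ) : TopologicalSpace (S ω N) :=
  seminormTopology (ι := ℕ+ × MultiIndex N) fun k =>
    wsupSeminorm (V := S ω N) (fun x : Rn N => ENNReal.ofReal (Real.exp ((k.1 : ℝ) * ω ‖x‖)))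
      (fun f => mderiv k.2 (f : Rn N → ℂ))
      (fun f g => mderiv_add _ f.2.2.1 g.2.2.1)
      (fun a f => mderiv_smul _ a f.2.2.1)
      (fun f => (f.2.2.2.2 (k.1 : ℝ) k.2 (by exact_mod_cast k.1.pos)).1) +
    wsupSeminorm (V := S ω N) (fun x : Rn N => ENNReal.ofReal (Real.exp ((k.1 : ℝ) * ω ‖x‖)))
      (fun f => mderiv k.2 (fourier (f : Rn N → ℂ)))
      (fun f g => by
        rw [Submodule.coe_add, fourier_add f.2.1 g.2.1, mderiv_add _ f.2.2.2.1 g.2.2.2.1])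
      (fun a f => by rw [Submodule.coe_smul, fourier_smul, mderiv_smul _ a f.2.2.2.1])
      (fun f => (f.2.2.2.2 (k.1 : ℝ) k.2 (by exact_mod_cast k.1.pos)).2)

/-- `W` is a dense subspace of `V`, where `V` carries the topology `t`. -/
def IsDenseSubspace {N : ℕ} (W V : Submodule ℂ (Rn N → ℂ)) (t : TopologicalSpace V) : Prop :=
  W ≤ V ∧ @Dense V t {f : V | (f : Rn N → ℂ) ∈ W}

end BeurlingSpaces

end

/-!
Write `M_m(k) = sup_{r ≥ 1} r ^ k exp(-m ω(r))`, which is `exp(m φ*(k/m))` (`moment`,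
`exp_mul_youngConj`). Membership in the spaces other than `S` then means that the derivatives of
order `k` are bounded by `M_m(k)`, locally or up to a factor `exp(n ω)`. Three properties of these
numbers carry the argument: they are supermultiplicative in `k` (`moment_mul_le`); by the doubling
condition geometric factors `2 ^ k` are absorbed when `m` is enlarged
(`exists_two_pow_mul_moment_le`); and, by convexity, `inf_k M_m(k) r ^ (-k) ≤ r exp(-m ω(r))`
(`exists_moment_le`). The first two make bounds by moments stable under products and under
commutators with coordinates.

All four density statements come from cutoffs: with `χ_j = 1` on the ball of radius `j + 1`,
compactly supported, and with derivatives bounded by `C_m M_m(k)` uniformly in `j` (`IsCutoff`),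
the functions `χ_j f` belong to `D` and converge to `f` in each of the topologies. For `E` the
seminorms of the difference vanish eventually. For `O_C` and `O_M` the difference vanishes on the
ball, so that measuring it with the weight `exp((n + 1) ω)` in place of `exp(n ω)` gains the factor
`exp(-ω(j + 1))` (`IsCutoff.exists_r_sub_le`); convergence in one step of an inductive limit gives
convergence in the limit.

Cutoffs exist because `ω` is not quasianalytic (`exists_isCutoff`). The convergence of
`∫ ω(t) t⁻² dt` yields a summable sequence `a_i` with `∏_{i < k} 1 / a_i ≤ C_m M_m(k)` for every `m`
(`exists_sequence`). Averaging a smooth bump function successively over intervals of half-length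
`a_0, a_1, …` converges with all derivatives; the support grows by at most `∑ a_i`, and since an
average of half-length `a` turns a derivative into a difference quotient with step `2 a`, the `k`-th
derivative of the limit is at most `∏_{i < k} 1 / a_i` times the supremum of the bump function.

For the space `S` both sides of the Fourier transform are compared. By Fourier inversion, an element
of `S` satisfies `|∂^α f| ≤ C M_m(|α|)`, because `|ξ| ^ k ≤ C M_m(k) exp(m ω(ξ))`; since `S` is
stable under multiplication by coordinates, it even satisfies these bounds with any polynomial
weight (`momentDecay_of_mem_S`). Conversely, such bounds give `|fourier f| ≤ C exp(-n ω)`, by taking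
at each `ξ` the number of derivatives supplied by `exists_moment_le`, and the constant `C` is linear
in the bounds (`exists_expWeight_mul_dlist_fourier_le`). This proves `D ⊆ S ⊆ O_C`, and it turns the
convergence of `χ_j f` to `f` in polynomially weighted moment bounds into convergence of the Fourier
transforms.
-/

namespace BeurlingSpaces

open scoped ENNReal
open Filter Topology MeasureTheory

/-! ### Weight functions and their moments -/

namespace Weight

variable (ω : Weight)

theorem mono {s t : ℝ} (hs : 0 ≤ s) (hst : s ≤ t) : ω s ≤ ω t :=
  ω.monotoneOn (Set.mem_Ici.2 hs) (Set.mem_Ici.2 (hs.trans hst)) hst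

theorem tendsto_atTop : Tendsto ω atTop atTop := by
  obtain ⟨a, b, hb, h⟩ := ω.log_le
  refine tendsto_atTop_mono' atTop ((eventually_ge_atTop 0).mono fun t ht => h t ht) ?_
  exact tendsto_atTop_add_const_left _ _ <| Tendsto.const_mul_atTop hb <|
    Real.tendsto_log_atTop.comp (tendsto_atTop_add_const_left _ _ tendsto_id)

theorem exists_mul_le (c : ℕ) :
    ∃ K : ℝ, 1 ≤ K ∧ ∀ t, 0 ≤ t → ω (c * t) ≤ K * (1 + ω t) := by
  have h : ∀ j : ℕ, ∃ K : ℝ, 1 ≤ K ∧ ∀ t, 0 ≤ t → ω (2 ^ j * t) ≤ K * (1 + ω t) := by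
    intro j
    induction j with
    | zero => exact ⟨1, le_rfl, fun t _ => by simp⟩
    | succ j ih =>
      obtain ⟨K, hK, h⟩ := ih
      obtain ⟨K', hK', h'⟩ := ω.doubling
      refine ⟨K' * (2 * K), by nlinarith, fun t ht => ?_⟩
      have h1 := h' (2 ^ j * t) (by positivity)
      have h2 := h t ht
      have h3 := ω.nonneg t ht
      rw [pow_succ', mul_assoc]
      refine h1.trans ?_
      rw [mul_assoc]
      gcongr
      nlinarith
  obtain ⟨K, hK, h⟩ := h c
  refine ⟨K, hK, fun t ht => le_trans (ω.mono (by positivity) ?_) (h t ht)⟩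
  gcongr
  exact_mod_cast (Nat.lt_two_pow_self (n := c)).le

/-- By `(γ)`, polynomials are dominated by exponentials of the weight. -/
theorem exists_pow_le (p : ℕ) :
    ∃ (l : ℕ+) (C : ℝ), 0 < C ∧ ∀ t, 0 ≤ t → (1 + t) ^ p ≤ C * Real.exp (l * ω t) := by
  obtain ⟨a, b, hb, h⟩ := ω.log_le
  obtain ⟨l, hl⟩ := exists_nat_ge (p / b)
  refine ⟨l.succPNat, Real.exp (-(l + 1) * a), Real.exp_pos _, fun t ht => ?_⟩
  have h1 := h t ht
  have h2 : 0 ≤ Real.log (1 + t) := Real.log_nonneg (by linarith)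
  have h3 : (p : ℝ) ≤ l * b := by rwa [div_le_iff₀ hb] at hl
  rw [← Real.exp_add, ← Real.rpow_natCast, Real.rpow_def_of_pos (by linarith)]
  gcongr
  push_cast [Nat.succPNat_coe]
  have h4 : Real.log (1 + t) * p ≤ Real.log (1 + t) * (l * b) := by gcongr
  have h5 : 0 ≤ b * Real.log (1 + t) := by positivity
  have h6 : ((l : ℝ) + 1) * (a + b * Real.log (1 + t)) ≤ (l + 1) * ω t := by gcongr
  nlinarith

end Weight

/-- The quantity `sup_{r ≥ 1} r ^ k exp(-m ω(r))`, with `r = exp t`. It equals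
`exp(m φ*(k/m))`, see `exp_mul_youngConj`; all estimates are carried out in terms of it. -/
noncomputable def moment (ω : Weight) (m : ℝ) (k : ℕ) : ℝ≥0∞ :=
  ⨆ (t : ℝ) (_ : 0 ≤ t), ENNReal.ofReal (Real.exp (k * t - m * ω (Real.exp t)))

theorem exp_mul_youngConj (ω : Weight) {m : ℝ} (hm : 0 < m) (k : ℕ) :
    EReal.exp ((m : EReal) * youngConj ω ((k : ℝ) / m)) = moment ω m k := by
  have hexp (x : EReal) : EReal.exp x = EReal.expOrderIso x := rfl
  rw [mul_comm, EReal.exp_mul, youngConj, hexp, OrderIso.map_iSup,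
    ← ENNReal.orderIsoRpow_apply m hm, OrderIso.map_iSup, moment]
  simp_rw [OrderIso.map_iSup, ← hexp, ENNReal.orderIsoRpow_apply, EReal.exp_coe]
  refine iSup_congr fun t => iSup_congr fun _ => ?_
  rw [ENNReal.ofReal_rpow_of_pos (Real.exp_pos _), ← Real.exp_mul]
  congr 2
  field_simp

section moment

variable {ω : Weight} {m : ℝ}

theorem le_moment (k : ℕ) {t : ℝ} (ht : 0 ≤ t) :
    ENNReal.ofReal (Real.exp (k * t - m * ω (Real.exp t))) ≤ moment ω m k :=
  le_iSup₂_of_le t ht le_rfl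

theorem moment_le {k : ℕ} {c : ℝ≥0∞}
    (h : ∀ t, 0 ≤ t → ENNReal.ofReal (Real.exp (k * t - m * ω (Real.exp t))) ≤ c) :
    moment ω m k ≤ c :=
  iSup₂_le h

theorem moment_ne_zero (k : ℕ) : moment ω m k ≠ 0 := by
  refine (lt_of_lt_of_le ?_ (le_moment k le_rfl)).ne'
  exact ENNReal.ofReal_pos.2 (Real.exp_pos _)

theorem moment_mono {j k : ℕ} (h : j ≤ k) : moment ω m j ≤ moment ω m k :=
  moment_le fun t ht => le_trans (by gcongr) (le_moment k ht)

theorem moment_anti {m' : ℝ} (h : m ≤ m') (k : ℕ) : moment ω m' k ≤ moment ω m k := by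
  refine moment_le fun t ht => le_trans ?_ (le_moment k ht)
  have := ω.nonneg _ (Real.exp_pos t).le
  gcongr

theorem moment_mul_le (hm : 0 ≤ m) (j k : ℕ) :
    moment ω m j * moment ω m k ≤ moment ω m (j + k) := by
  conv_lhs => rw [moment, moment]
  simp only [ENNReal.iSup_mul, ENNReal.mul_iSup]
  refine iSup₂_le fun s hs => iSup₂_le fun t ht => ?_
  rw [← ENNReal.ofReal_mul (Real.exp_pos _).le, ← Real.exp_add]
  have h1 := ω.nonneg _ (Real.exp_pos s).le
  have h2 := ω.nonneg _ (Real.exp_pos t).le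
  rcases le_total s t with h | h
  · refine le_trans ?_ (le_moment _ ht)
    gcongr
    push_cast
    have : (j : ℝ) * s ≤ j * t := by gcongr
    nlinarith [mul_nonneg hm h1]
  · refine le_trans ?_ (le_moment _ hs)
    gcongr
    push_cast
    have : (k : ℝ) * t ≤ k * s := by gcongr
    nlinarith [mul_nonneg hm h2]

theorem moment_zero_le (hm : 0 ≤ m) : moment ω m 0 ≤ 1 := by
  refine moment_le fun t _ => ?_
  rw [ENNReal.ofReal_le_one, Real.exp_le_one_iff]
  have := ω.nonneg _ (Real.exp_pos t).le
  have := mul_nonneg hm this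
  simpa using this

/-- The doubling condition `(α)` absorbs geometric factors into the moments. -/
theorem exists_two_pow_mul_moment_le (ω : Weight) (m : ℕ+) :
    ∃ (m' : ℕ+) (C : ℝ≥0∞), m ≤ m' ∧ C ≠ ∞ ∧
      ∀ k, 2 ^ k * moment ω (m' : ℝ) k ≤ C * moment ω (m : ℝ) k := by
  obtain ⟨K, hK, h⟩ := ω.doubling
  obtain ⟨L, hL⟩ : ∃ L : ℕ+, K ≤ L := by
    obtain ⟨L, hL⟩ := exists_nat_ge K
    exact ⟨L.succPNat, hL.trans (by simp)⟩
  refine ⟨m * L, ENNReal.ofReal (Real.exp (m * L)), ?_, ENNReal.ofReal_ne_top, fun k => ?_⟩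
  · exact le_mul_of_one_le_right' one_le
  · rw [moment]
    simp only [ENNReal.mul_iSup]
    refine iSup₂_le fun t ht => ?_
    have h2 : (0 : ℝ) ≤ Real.log 2 := Real.log_nonneg (by norm_num)
    refine le_trans ?_ (mul_le_mul_right
      (le_moment k (t := t + Real.log 2) (by positivity)) _)
    have e : (2 : ℝ≥0∞) ^ k = ENNReal.ofReal (Real.exp (k * Real.log 2)) := by
      rw [mul_comm, Real.exp_mul, Real.exp_log (by norm_num), Real.rpow_natCast,
        ENNReal.ofReal_pow (by norm_num)]
      simp
    rw [e, ← ENNReal.ofReal_mul (Real.exp_pos _).le, ← ENNReal.ofReal_mul (Real.exp_pos _).le,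
      ← Real.exp_add, ← Real.exp_add, Real.exp_add t, Real.exp_log (by norm_num)]
    refine ENNReal.ofReal_le_ofReal (Real.exp_le_exp.2 ?_)
    have h3 := h _ (Real.exp_pos t).le
    have h4 := ω.nonneg _ (Real.exp_pos t).le
    have h5 : K * (1 + ω (Real.exp t)) ≤ L * (1 + ω (Real.exp t)) := by gcongr
    have h6 : (m : ℝ) * ω (2 * Real.exp t) ≤ m * (L * (1 + ω (Real.exp t))) := by
      gcongr
      exact h3.trans h5
    have h7 : ((m * L : ℕ+) : ℝ) = m * L := by push_cast; rfl
    rw [mul_comm (Real.exp t) 2, h7]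
    linarith

theorem exists_moment_lt_top (ω : Weight) (k : ℕ) : ∃ m : ℕ+, moment ω (m : ℝ) k < ∞ := by
  obtain ⟨l, C, hC, h⟩ := ω.exists_pow_le k
  refine ⟨l, lt_of_le_of_lt (moment_le (c := ENNReal.ofReal C) fun t _ => ?_)
    ENNReal.ofReal_lt_top⟩
  gcongr
  rw [Real.exp_sub, div_le_iff₀ (Real.exp_pos _)]
  refine le_trans ?_ (h _ (Real.exp_pos t).le)
  rw [mul_comm, Real.exp_mul, Real.rpow_natCast]
  gcongr
  linarith

theorem pow_le_moment (ω : Weight) (hm : 0 ≤ m) (k : ℕ) {r : ℝ} (hr : 0 ≤ r) :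
    ENNReal.ofReal (r ^ k) ≤
      ENNReal.ofReal (Real.exp (m * ω 1 + m * ω r)) * moment ω m k := by
  have key : ∀ s, 1 ≤ s →
      ENNReal.ofReal (s ^ k) ≤ ENNReal.ofReal (Real.exp (m * ω s)) * moment ω m k := by
    intro s hs
    have hs0 : 0 < s := by linarith
    refine le_trans (le_of_eq ?_) (mul_le_mul_right
      (le_moment k (t := Real.log s) (Real.log_nonneg hs)) _)
    rw [← ENNReal.ofReal_mul (Real.exp_pos _).le, ← Real.exp_add, Real.exp_log hs0,
      add_sub_cancel, mul_comm (k : ℝ), Real.exp_mul, Real.exp_log hs0, Real.rpow_natCast]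
  have h1 := mul_nonneg hm (ω.nonneg 1 zero_le_one)
  have h2 := mul_nonneg hm (ω.nonneg r hr)
  rcases le_total 1 r with h | h
  · refine (key r h).trans ?_
    gcongr
    linarith
  · refine le_trans ?_ ((key 1 le_rfl).trans ?_)
    · gcongr
    · gcongr
      linarith

/-- Biduality for the Young conjugate, at integer arguments: the exponent `k` is the integer part
of the slope of a supporting line of the convex function `t ↦ m ω(exp t)`; rounding costs a
factor `exp t`. -/
theorem exists_moment_le (ω : Weight) (hm : 0 ≤ m) {t : ℝ} (ht : 0 ≤ t) :
    ∃ k : ℕ, moment ω m k ≤ ENNReal.ofReal (Real.exp (k * t + t - m * ω (Real.exp t))) := by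
  set f : ℝ → ℝ := fun u => m * ω (Real.exp u) with hf
  have hconv : ConvexOn ℝ Set.univ f := ω.convex.smul hm
  have hmono : ∀ u v, u ≤ v → f u ≤ f v := fun u v huv => by
    have := ω.mono (Real.exp_pos u).le (Real.exp_le_exp.2 huv)
    simp only [hf]
    gcongr
  set s := derivWithin f (Set.Ioi t) t with hs
  have hright : ∀ u, t < u → s ≤ slope f t u := fun u hu =>
    hconv.rightDeriv_le_slope_of_mem_interior (by simp) (by simp) hu
  have hleft : ∀ u, u < t → slope f u t ≤ s := fun u hu =>
    (hconv.slope_le_leftDeriv_of_mem_interior (by simp) (by simp) hu).trans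
      (hconv.leftDeriv_le_rightDeriv_of_mem_interior (by simp))
  have hsupp : ∀ u, f t + s * (u - t) ≤ f u := by
    intro u
    rcases lt_trichotomy t u with h | h | h
    · have := hright u h
      rw [slope_def_field, le_div_iff₀ (by linarith)] at this
      linarith
    · simp [h]
    · have := hleft u h
      rw [slope_def_field, div_le_iff₀ (by linarith)] at this
      linarith
  have hs0 : 0 ≤ s := by
    have h1 := hsupp (t - 1)
    have h2 := hmono (t - 1) t (by linarith)
    linarith
  refine ⟨⌊s⌋₊, moment_le fun u hu => ?_⟩
  refine ENNReal.ofReal_le_ofReal (Real.exp_le_exp.2 ?_)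
  have h1 := hsupp u
  have h2 := Nat.floor_le hs0
  have h3 := (Nat.lt_floor_add_one s).le
  simp only [hf] at h1
  nlinarith [mul_nonneg (sub_nonneg.2 h2) hu, mul_nonneg (sub_nonneg.2 h3) ht]

end moment

theorem rWeight_eq (ω : Weight) (N : ℕ) (m : ℕ+) (n : ℤ) (q : MultiIndex N × Rn N) :
    rWeight ω N m n q =
      ENNReal.ofReal (Real.exp (-(n * ω ‖q.2‖))) * (moment ω m q.1.order)⁻¹ := by
  have hm : (0 : ℝ) < m := by exact_mod_cast m.pos
  rw [rWeight, sub_eq_add_neg, EReal.exp_add, EReal.exp_neg (((m : ℝ) : EReal) * _),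
    exp_mul_youngConj ω hm, ← EReal.coe_neg, EReal.exp_coe]

theorem pWeight_eq (ω : Weight) {N : ℕ} (K : TopologicalSpace.Compacts (Rn N)) (m : ℕ+)
    (q : MultiIndex N × K) : pWeight ω K m q = (moment ω m q.1.order)⁻¹ := by
  have hm : (0 : ℝ) < m := by exact_mod_cast m.pos
  rw [pWeight, EReal.exp_neg, exp_mul_youngConj ω hm]

/-! ### Derivatives along lists of indices -/

section dlist

variable {N : ℕ}

/-- The derivative `∂_{i₁} ⋯ ∂_{i_k} f` along a list of indices. For smooth functions these are
the derivatives `mderiv α f` (`exists_mderiv_eq_dlist`, `exists_dlist_eq_mderiv`), but lists are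
better suited for inductions. -/
noncomputable def dlist (l : List (Fin N)) (f : Rn N → ℂ) : Rn N → ℂ := l.foldr pderiv f

@[simp] theorem dlist_nil (f : Rn N → ℂ) : dlist [] f = f := rfl

theorem dlist_cons (i : Fin N) (l : List (Fin N)) (f : Rn N → ℂ) :
    dlist (i :: l) f = pderiv i (dlist l f) := rfl

theorem dlist_append (l l' : List (Fin N)) (f : Rn N → ℂ) :
    dlist (l ++ l') f = dlist l (dlist l' f) := by
  simp [dlist]

theorem dlist_concat (l : List (Fin N)) (i : Fin N) (f : Rn N → ℂ) :
    dlist (l ++ [i]) f = dlist l (pderiv i f) := dlist_append l [i] f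

theorem contDiff_of_mem_smooth {f : Rn N → ℂ} (hf : f ∈ Smooth N) :
    ContDiff ℝ ((⊤ : ℕ∞) : WithTop ℕ∞) f := hf

theorem mem_smooth_of_contDiff {f : Rn N → ℂ} (hf : ContDiff ℝ ((⊤ : ℕ∞) : WithTop ℕ∞) f) :
    f ∈ Smooth N := hf

theorem differentiable_of_mem_smooth {f : Rn N → ℂ} (hf : f ∈ Smooth N) : Differentiable ℝ f :=
  (contDiff_of_mem_smooth hf).differentiable (by simp)

theorem continuous_of_mem_smooth {f : Rn N → ℂ} (hf : f ∈ Smooth N) : Continuous f :=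
  (contDiff_of_mem_smooth hf).continuous

theorem mul_mem_smooth {f g : Rn N → ℂ} (hf : f ∈ Smooth N) (hg : g ∈ Smooth N) :
    f * g ∈ Smooth N :=
  mem_smooth_of_contDiff ((contDiff_of_mem_smooth hf).mul (contDiff_of_mem_smooth hg))

theorem dlist_mem (l : List (Fin N)) {f : Rn N → ℂ} (hf : f ∈ Smooth N) :
    dlist l f ∈ Smooth N := by
  induction l with
  | nil => exact hf
  | cons i l ih => exact pderiv_mem i ih

theorem dlist_add (l : List (Fin N)) {f g : Rn N → ℂ} (hf : f ∈ Smooth N) (hg : g ∈ Smooth N) :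
    dlist l (f + g) = dlist l f + dlist l g := by
  induction l with
  | nil => rfl
  | cons i l ih => rw [dlist_cons, ih, pderiv_add i (dlist_mem l hf) (dlist_mem l hg)]; rfl

theorem dlist_smul (l : List (Fin N)) (c : ℂ) {f : Rn N → ℂ} (hf : f ∈ Smooth N) :
    dlist l (c • f) = c • dlist l f := by
  induction l with
  | nil => rfl
  | cons i l ih => rw [dlist_cons, ih, pderiv_smul i c (dlist_mem l hf)]; rfl

theorem dlist_zero (l : List (Fin N)) : dlist l (0 : Rn N → ℂ) = 0 := by
  simpa using dlist_smul l 0 (zero_mem (Smooth N))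

theorem pderiv_comm (i j : Fin N) {f : Rn N → ℂ} (hf : f ∈ Smooth N) :
    pderiv i (pderiv j f) = pderiv j (pderiv i f) := by
  have h := contDiff_of_mem_smooth hf
  have h1 : ContDiff ℝ ((⊤ : ℕ∞) : WithTop ℕ∞) (fderiv ℝ f) := h.fderiv_right (by simp)
  have key : ∀ (a b : Fin N) (x : Rn N), pderiv a (pderiv b f) x =
      fderiv ℝ (fderiv ℝ f) x (EuclideanSpace.single a 1) (EuclideanSpace.single b 1) := by
    intro a b x
    have h2 : HasFDerivAt (fderiv ℝ f) (fderiv ℝ (fderiv ℝ f) x) x :=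
      (h1.differentiable (by simp) x).hasFDerivAt
    have h3 := h2.clm_apply (hasFDerivAt_const (EuclideanSpace.single b (1 : ℝ)) x)
    rw [pderiv, show pderiv b f = fun y => fderiv ℝ f y (EuclideanSpace.single b 1) from rfl,
      h3.fderiv]
    simp
  ext x
  rw [key, key]
  exact (h.contDiffAt (x := x)).isSymmSndFDerivAt
    (by simpa using (WithTop.coe_le_coe.2 le_top :
      ((2 : ℕ∞) : WithTop ℕ∞) ≤ ((⊤ : ℕ∞) : WithTop ℕ∞))) _ _

theorem dlist_perm {l l' : List (Fin N)} (h : l.Perm l') {f : Rn N → ℂ} (hf : f ∈ Smooth N) :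
    dlist l f = dlist l' f := by
  induction h with
  | nil => rfl
  | cons i _ ih => rw [dlist_cons, ih, dlist_cons]
  | swap i j l =>
    simp only [dlist_cons]
    exact pderiv_comm j i (dlist_mem l hf)
  | trans _ _ ih1 ih2 => rw [ih1, ih2]

theorem mderiv_eq_dlist (α : MultiIndex N) (f : Rn N → ℂ) :
    mderiv α f = dlist ((List.finRange N).flatMap fun i => List.replicate (α i) i) f := by
  rw [mderiv]
  induction List.finRange N with
  | nil => rfl
  | cons i l ih =>
    rw [List.foldr_cons, ih, List.flatMap_cons, dlist_append]
    generalize dlist _ f = g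
    induction α i with
    | zero => rfl
    | succ k ihk => rw [Function.iterate_succ_apply', ihk, List.replicate_succ, dlist_cons]

theorem length_flatMap_replicate (α : MultiIndex N) :
    ((List.finRange N).flatMap fun i => List.replicate (α i) i).length = α.order := by
  rw [List.length_flatMap, MultiIndex.order]
  simp [List.sum_ofFn, ← List.ofFn_eq_map]

theorem exists_dlist_eq_mderiv (α : MultiIndex N) :
    ∃ l : List (Fin N), l.length = α.order ∧ ∀ f, mderiv α f = dlist l f :=
  ⟨_, length_flatMap_replicate α, mderiv_eq_dlist α⟩

theorem exists_mderiv_eq_dlist (l : List (Fin N)) :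
    ∃ α : MultiIndex N, α.order = l.length ∧ ∀ f ∈ Smooth N, dlist l f = mderiv α f := by
  set α : MultiIndex N := fun i => l.count i with hα
  have hp : l.Perm ((List.finRange N).flatMap fun i => List.replicate (α i) i) := by
    rw [List.perm_iff_count]
    intro a
    rw [List.count_flatMap]
    simp only [Function.comp_def, List.count_replicate]
    rw [← List.ofFn_eq_map, List.sum_ofFn]
    simp [hα]
  refine ⟨α, ?_, fun f hf => ?_⟩
  · rw [hp.length_eq, length_flatMap_replicate]
  · rw [mderiv_eq_dlist, dlist_perm hp hf]

theorem forall_dlist_iff {f : Rn N → ℂ} (hf : f ∈ Smooth N) (x : Rn N) (c : ℕ → ℝ≥0∞) :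
    (∀ l : List (Fin N), ‖dlist l f x‖ₑ ≤ c l.length) ↔
      ∀ α : MultiIndex N, ‖mderiv α f x‖ₑ ≤ c α.order := by
  refine ⟨fun h α => ?_, fun h l => ?_⟩
  · obtain ⟨l, hl, hl'⟩ := exists_dlist_eq_mderiv α
    rw [hl', ← hl]
    exact h l
  · obtain ⟨α, hα, hα'⟩ := exists_mderiv_eq_dlist l
    rw [hα' f hf, ← hα]
    exact h α

theorem dlist_congr {f g : Rn N → ℂ} {x : Rn N} (h : f =ᶠ[𝓝 x] g) (l : List (Fin N)) :
    dlist l f =ᶠ[𝓝 x] dlist l g := by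
  induction l with
  | nil => exact h
  | cons i l ih =>
    filter_upwards [ih.fderiv (𝕜 := ℝ)] with y hy
    rw [dlist_cons, dlist_cons, pderiv, pderiv, hy]

theorem dlist_eq_zero_of_eventuallyEq {f : Rn N → ℂ} {x : Rn N} (h : f =ᶠ[𝓝 x] 0)
    (l : List (Fin N)) : dlist l f x = 0 := by
  rw [(dlist_congr h l).eq_of_nhds, dlist_zero]
  rfl

theorem pderiv_mul (i : Fin N) {f g : Rn N → ℂ} (hf : f ∈ Smooth N) (hg : g ∈ Smooth N) :
    pderiv i (f * g) = pderiv i f * g + f * pderiv i g := by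
  ext x
  simp only [pderiv, Pi.add_apply, Pi.mul_apply]
  rw [fderiv_mul (differentiable_of_mem_smooth hf x) (differentiable_of_mem_smooth hg x)]
  simp only [add_apply, smul_apply, smul_eq_mul]
  ring

/-- A form of the Leibniz rule: bounds by a supermultiplicative sequence are stable under
products, up to a geometric factor. -/
theorem enorm_dlist_mul_le {M : ℕ → ℝ≥0∞} (hM : ∀ j k, M j * M k ≤ M (j + k)) {A B : ℝ≥0∞}
    {x : Rn N} (l : List (Fin N)) : ∀ {f g : Rn N → ℂ} (_ : f ∈ Smooth N) (_ : g ∈ Smooth N)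
    (p q : ℕ) (_ : ∀ l : List (Fin N), ‖dlist l f x‖ₑ ≤ A * M (p + l.length))
    (_ : ∀ l : List (Fin N), ‖dlist l g x‖ₑ ≤ B * M (q + l.length)),
    ‖dlist l (f * g) x‖ₑ ≤ A * B * (2 ^ l.length * M (p + q + l.length)) := by
  induction l using List.reverseRecOn with
  | nil =>
    intro f g _ _ p q hA hB
    have h1 := hA []
    have h2 := hB []
    simp only [dlist_nil, List.length_nil, add_zero, pow_zero, one_mul] at h1 h2 ⊢
    rw [Pi.mul_apply, enorm_mul]
    refine (mul_le_mul' h1 h2).trans ?_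
    rw [mul_mul_mul_comm]
    gcongr
    exact hM p q
  | append_singleton l i ih =>
    intro f g hf hg p q hA hB
    rw [dlist_concat, pderiv_mul i hf hg, dlist_add l (mul_mem_smooth (pderiv_mem i hf) hg)
      (mul_mem_smooth hf (pderiv_mem i hg)), Pi.add_apply]
    have h1 := ih (pderiv_mem i hf) hg (p + 1) q (fun l => by
      have := hA (l ++ [i])
      rwa [dlist_concat, List.length_append, List.length_singleton, add_comm l.length,
        ← add_assoc] at this) hB
    have h2 := ih hf (pderiv_mem i hg) p (q + 1) hA (fun l => by
      have := hB (l ++ [i])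
      rwa [dlist_concat, List.length_append, List.length_singleton, add_comm l.length,
        ← add_assoc] at this)
    refine (enorm_add_le _ _).trans ((add_le_add h1 h2).trans (le_of_eq ?_))
    rw [List.length_append, List.length_singleton, show p + 1 + q + l.length =
      p + q + (l.length + 1) by ring, show p + (q + 1) + l.length = p + q + (l.length + 1) by ring]
    ring

/-- The function `x ↦ x i * f x`. -/
def coordMul (i : Fin N) (f : Rn N → ℂ) : Rn N → ℂ := fun x => (x i : ℂ) * f x

theorem coord_mem_smooth (i : Fin N) : (fun x : Rn N => ((x i : ℝ) : ℂ)) ∈ Smooth N :=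
  mem_smooth_of_contDiff <|
    (Complex.ofRealCLM.contDiff).comp (EuclideanSpace.proj (𝕜 := ℝ) i).contDiff

theorem coordMul_mem_smooth (i : Fin N) {f : Rn N → ℂ} (hf : f ∈ Smooth N) :
    coordMul i f ∈ Smooth N :=
  mul_mem_smooth (coord_mem_smooth i) hf

theorem pderiv_coord (i j : Fin N) :
    pderiv j (fun x : Rn N => ((x i : ℝ) : ℂ)) = fun _ => if j = i then 1 else 0 := by
  ext x
  have h : HasFDerivAt (fun x : Rn N => ((x i : ℝ) : ℂ))
      (Complex.ofRealCLM.comp (EuclideanSpace.proj (𝕜 := ℝ) i)) x :=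
    (Complex.ofRealCLM.comp (EuclideanSpace.proj (𝕜 := ℝ) i)).hasFDerivAt
  rw [pderiv, h.fderiv]
  simp [eq_comm]
  split_ifs <;> simp

theorem pderiv_coordMul (i j : Fin N) {f : Rn N → ℂ} (hf : f ∈ Smooth N) :
    pderiv j (coordMul i f) = (if j = i then f else 0) + coordMul i (pderiv j f) := by
  rw [show coordMul i f = (fun x : Rn N => ((x i : ℝ) : ℂ)) * f from rfl,
    pderiv_mul j (coord_mem_smooth i) hf, pderiv_coord]
  congr 1
  ext x
  split_ifs <;> simp

/-- The commutator of `x i` with a derivative of order `k` consists of at most `k` derivatives of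
order `k - 1`. -/
theorem enorm_dlist_coordMul_sub_le (i : Fin N) {x : Rn N} {B : ℝ≥0∞} (l : List (Fin N)) :
    ∀ {f : Rn N → ℂ} (_ : f ∈ Smooth N)
    (_ : ∀ l' : List (Fin N), l'.length + 1 = l.length → ‖dlist l' f x‖ₑ ≤ B),
    ‖dlist l (coordMul i f) x - (x i : ℂ) * dlist l f x‖ₑ ≤ l.length * B := by
  induction l using List.reverseRecOn with
  | nil =>
    intro f _ _
    simp [coordMul]
  | append_singleton l j ih =>
    intro f hf hB
    have h0 : (if j = i then f else 0) ∈ Smooth N := by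
      split_ifs
      exacts [hf, zero_mem _]
    rw [dlist_concat, dlist_concat, pderiv_coordMul i j hf,
      dlist_add l h0 (coordMul_mem_smooth i (pderiv_mem j hf)), Pi.add_apply, add_sub_assoc]
    refine (enorm_add_le _ _).trans ?_
    have h1 : ‖dlist l (if j = i then f else 0) x‖ₑ ≤ B := by
      split_ifs
      · exact hB l (by simp)
      · simp [dlist_zero]
    have h2 := ih (pderiv_mem j hf) (fun l' hl' => by
      rw [← dlist_concat]
      exact hB _ (by simp [hl']))
    refine (add_le_add h1 h2).trans (le_of_eq ?_)
    rw [List.length_append, List.length_singleton]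
    push_cast
    ring

theorem enorm_le_add_enorm_sub (a b : ℂ) : ‖a‖ₑ ≤ ‖b‖ₑ + ‖a - b‖ₑ := by
  calc ‖a‖ₑ = ‖b + (a - b)‖ₑ := by rw [add_sub_cancel]
    _ ≤ _ := enorm_add_le _ _

end dlist

/-! ### A summable sequence adapted to the weight -/

section radii

theorem Weight.exists_eq (ω : Weight) {y : ℝ} (hy : ω 1 ≤ y) : ∃ t, 1 ≤ t ∧ ω t = y := by
  obtain ⟨T, hT, hT1⟩ := ((ω.tendsto_atTop.eventually_ge_atTop y).and
    (eventually_ge_atTop 1)).exists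
  have hc : ContinuousOn ω (Set.Icc 1 T) :=
    ω.continuousOn.mono fun t ht => zero_le_one.trans ht.1
  obtain ⟨t, ht, h⟩ := intermediate_value_Icc hT1 hc ⟨hy, hT⟩
  exact ⟨t, ht.1, h⟩

/-- Non-quasianalyticity `(β)` in discrete form: the radii at which `ω` passes the levels
`ω 1 + k / c` have summable reciprocals. This is the layer cake formula for
`∫ ω(t) t⁻² dt`. -/
theorem exists_radii (ω : Weight) {c : ℝ} (hc : 0 < c) :
    ∃ r : ℕ → ℝ, (∀ k, 1 ≤ r k) ∧ Monotone r ∧ (∀ k, ω (r k) = k / c + ω 1) ∧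
      Summable fun k => (r k)⁻¹ := by
  choose r hr1 hr using fun k : ℕ => ω.exists_eq (y := k / c + ω 1) (by
    have : 0 ≤ (k : ℝ) / c := by positivity
    linarith)
  refine ⟨r, hr1, ?_, hr, ?_⟩
  · intro j k hjk
    rcases hjk.eq_or_lt with rfl | h
    · exact le_rfl
    · by_contra hlt
      have h1 := ω.mono (zero_le_one.trans (hr1 k)) (not_le.1 hlt).le
      rw [hr, hr] at h1
      have h2 : (j : ℝ) / c < k / c := by gcongr
      linarith
  · set φ : ℝ → ℝ := fun t => 2 * c * (ω t / (1 + t ^ 2)) + t ^ (-2 : ℝ) with hφ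
    have hint2 : ∀ s : ℝ, 1 ≤ s → IntegrableOn (fun t : ℝ => t ^ (-2 : ℝ)) (Set.Ioi s) :=
      fun s hs => integrableOn_Ioi_rpow_of_lt (by norm_num) (by linarith)
    have hφi : IntegrableOn φ (Set.Ioi 1) :=
      ((ω.integrable.mono_set Set.Ioi_subset_Ici_self).const_mul _).add (hint2 1 le_rfl)
    refine summable_of_sum_range_le (c := ∫ t in Set.Ioi 1, φ t)
      (fun k => inv_nonneg.2 (zero_le_one.trans (hr1 k))) fun n => ?_
    have h1 : ∀ k, (r k)⁻¹ =
        ∫ t in Set.Ioi 1, (Set.Ioi (r k)).indicator (fun t : ℝ => t ^ (-2 : ℝ)) t := by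
      intro k
      rw [setIntegral_indicator measurableSet_Ioi, Set.Ioi_inter_Ioi, max_eq_right (hr1 k),
        integral_Ioi_rpow_of_lt (by norm_num) (by linarith [hr1 k])]
      norm_num
      rw [Real.rpow_neg_one]
    have h2 : ∀ k, IntegrableOn ((Set.Ioi (r k)).indicator (fun t : ℝ => t ^ (-2 : ℝ)))
        (Set.Ioi 1) := fun k => (hint2 1 le_rfl).indicator measurableSet_Ioi
    simp_rw [h1]
    rw [← integral_finsetSum _ fun k _ => h2 k]
    refine setIntegral_mono_on (integrable_finsetSum _ fun k _ => h2 k) hφi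
      measurableSet_Ioi fun t ht => ?_
    have ht1 : 1 < t := ht
    have hω := ω.nonneg t (by linarith)
    have h3 : ∀ k, (Set.Ioi (r k)).indicator (fun t : ℝ => t ^ (-2 : ℝ)) t =
        if r k < t then t ^ (-2 : ℝ) else 0 := fun k => by simp [Set.indicator_apply]
    simp_rw [h3]
    rw [← Finset.sum_filter, Finset.sum_const, nsmul_eq_mul]
    have hcard : ((Finset.filter (fun k => r k < t) (Finset.range n)).card : ℝ) ≤
        c * ω t + 1 := by
      have hsub : Finset.filter (fun k => r k < t) (Finset.range n) ⊆
          Finset.range (⌊c * ω t⌋₊ + 1) := by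
        intro k hk
        rw [Finset.mem_filter] at hk
        rw [Finset.mem_range, Nat.lt_succ_iff]
        refine Nat.le_floor ?_
        have h4 := ω.mono (zero_le_one.trans (hr1 k)) hk.2.le
        rw [hr] at h4
        have h5 := ω.nonneg 1 zero_le_one
        have h6 : (k : ℝ) / c ≤ ω t := by linarith
        rwa [div_le_iff₀ hc, mul_comm] at h6
      refine (Nat.cast_le.2 (Finset.card_le_card hsub)).trans ?_
      rw [Finset.card_range]
      push_cast
      gcongr
      exact Nat.floor_le (by positivity)
    have ht2 : t ^ (-2 : ℝ) = (t ^ 2)⁻¹ := by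
      rw [Real.rpow_neg (by linarith)]
      norm_num
    have h7 : (t ^ 2)⁻¹ ≤ 2 / (1 + t ^ 2) := by
      rw [inv_eq_one_div, div_le_div_iff₀ (by positivity) (by positivity)]
      nlinarith
    simp only [hφ, ht2]
    calc _ ≤ (c * ω t + 1) * (t ^ 2)⁻¹ := by gcongr
      _ = c * ω t * (t ^ 2)⁻¹ + (t ^ 2)⁻¹ := by ring
      _ ≤ c * ω t * (2 / (1 + t ^ 2)) + (t ^ 2)⁻¹ := by gcongr
      _ = _ := by ring

theorem exists_tsum_indicator_le {b : ℕ → ℝ} (hb : Summable b) {ε : ℝ} (hε : 0 < ε) :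
    ∃ K : ℕ, ∑' i, (Set.Ici K).indicator b i ≤ ε := by
  obtain ⟨K, hK⟩ := ((tendsto_sum_nat_add b).eventually_le_const hε).exists
  refine ⟨K, le_trans (le_of_eq ?_) hK⟩
  rw [← (hb.indicator (Set.Ici K)).sum_add_tsum_nat_add K, Finset.sum_eq_zero, zero_add]
  · simp
  · intro i hi
    exact Set.indicator_of_notMem (by simpa using hi) _

/-- A single summable sequence whose products of reciprocals are dominated by the moments for all
`m`. It dominates, from some index on, the reciprocals of the radii of `exists_radii` for every
level spacing, which is arranged by summing tails. -/
theorem exists_sequence (ω : Weight) :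
    ∃ a : ℕ → ℝ, (∀ i, 0 < a i) ∧ Summable a ∧ ∀ m : ℕ+, ∃ C : ℝ≥0∞, C ≠ ∞ ∧
      ∀ k, ENNReal.ofReal (∏ i ∈ Finset.range k, (a i)⁻¹) ≤ C * moment ω m k := by
  choose r hr1 hrm hr hrs using fun m : ℕ => exists_radii ω (c := m + 1) (by positivity)
  have hr0 : ∀ m k, 0 < r m k := fun m k => zero_lt_one.trans_le (hr1 m k)
  choose K hK using fun m : ℕ => exists_tsum_indicator_le (hrs m)
    (ε := (1 / 2) ^ m) (by positivity)
  set c : ℕ × ℕ → ℝ := fun q => (Set.Ici (K q.1)).indicator (fun k => (r q.1 k)⁻¹) q.2 with hc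
  have hc0 : ∀ q, 0 ≤ c q := fun q =>
    Set.indicator_nonneg (fun k _ => inv_nonneg.2 (hr0 q.1 k).le) _
  have hcs : Summable c := by
    refine (summable_prod_of_nonneg hc0).2 ⟨fun m => (hrs m).indicator _, ?_⟩
    exact Summable.of_nonneg_of_le (fun m => tsum_nonneg fun k => hc0 (m, k)) hK
      (summable_geometric_of_lt_one (by norm_num) (by norm_num))
  have hcs' := hcs.prod_symm
  set a : ℕ → ℝ := fun i => (1 / 2) ^ i + ∑' m, c (m, i) with ha
  have ha0 : ∀ i, 0 < a i := fun i =>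
    add_pos_of_pos_of_nonneg (by positivity) (tsum_nonneg fun m => hc0 (m, i))
  refine ⟨a, ha0, (summable_geometric_of_lt_one (by norm_num) (by norm_num)).add hcs'.prod,
    fun m₀ => ?_⟩
  have hac : ∀ m i, K m ≤ i → (a i)⁻¹ ≤ r m i := by
    intro m i hi
    have h1 : c (m, i) ≤ ∑' m, c (m, i) :=
      (hcs'.prod_factor i).le_tsum m fun m' _ => hc0 (m', i)
    have h2 : c (m, i) = (r m i)⁻¹ := Set.indicator_of_mem (Set.mem_Ici.2 hi) _
    refine inv_le_of_inv_le₀ (hr0 m i) ?_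
    have : (0 : ℝ) < (1 / 2) ^ i := by positivity
    simp only [ha]
    linarith
  obtain ⟨D, hD, hdbl⟩ := ω.doubling
  have hlog : 0 < Real.log 2 := Real.log_pos (by norm_num)
  obtain ⟨m, hm⟩ := exists_nat_ge (m₀ * D / Real.log 2)
  set u : ℕ → ℝ := fun k => ∏ i ∈ Finset.range k, (a i)⁻¹ with hu
  have hu0 : ∀ k, 0 < u k := fun k => Finset.prod_pos fun i _ => inv_pos.2 (ha0 i)
  set P : ℝ := ∑ k ∈ Finset.range (K m + 1), u k with hP
  have hP0 : 0 < P := Finset.sum_pos (fun k _ => hu0 k) (by simp)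
  have hur : ∀ k, u k ≤ P * r m k ^ k := by
    intro k
    have hsmall : ∀ k, k ≤ K m → u k ≤ P * r m k ^ k := by
      intro k hk
      have h1 : u k ≤ P := Finset.single_le_sum (f := u) (fun k _ => (hu0 k).le)
        (Finset.mem_range.2 (Nat.lt_succ_iff.2 hk))
      exact h1.trans (le_mul_of_one_le_right hP0.le (one_le_pow₀ (hr1 m k)))
    induction k with
    | zero => exact hsmall 0 (Nat.zero_le _)
    | succ k ih =>
      rcases le_or_gt (k + 1) (K m) with h | h
      · exact hsmall _ h
      · have h1 := hac m k (Nat.lt_succ_iff.1 h)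
        have h2 : r m k ≤ r m (k + 1) := hrm m (Nat.le_succ k)
        have h3 := (hr0 m k).le
        calc u (k + 1) = u k * (a k)⁻¹ := Finset.prod_range_succ _ _
          _ ≤ P * r m k ^ k * r m k :=
            mul_le_mul ih h1 (inv_nonneg.2 (ha0 k).le) (by positivity)
          _ = P * r m k ^ (k + 1) := by ring
          _ ≤ _ := by gcongr
  have hm0 : (0 : ℝ) < m₀ := by exact_mod_cast m₀.pos
  refine ⟨ENNReal.ofReal (P * Real.exp (m₀ * D * (1 + ω 1))), ENNReal.ofReal_ne_top,
    fun k => ?_⟩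
  -- the supremum defining the moment is tested at the radius `2 * r m k`
  have h2r : (1 : ℝ) ≤ 2 * r m k := by linarith [hr1 m k]
  have h2r0 : (0 : ℝ) < 2 * r m k := by linarith
  refine le_trans ?_ (mul_le_mul_right
    (le_moment (ω := ω) (m := m₀) k (t := Real.log (2 * r m k)) (Real.log_nonneg h2r)) _)
  have hE := Real.exp_pos (m₀ * D * (1 + ω 1))
  rw [← ENNReal.ofReal_mul (by positivity)]
  refine ENNReal.ofReal_le_ofReal ((hur k).trans ?_)
  rw [mul_assoc]
  refine mul_le_mul_of_nonneg_left ?_ hP0.le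
  have h4 : r m k ^ k = Real.exp (k * Real.log (r m k)) := by
    rw [mul_comm, Real.exp_mul, Real.exp_log (hr0 m k), Real.rpow_natCast]
  rw [h4, ← Real.exp_add, Real.exp_log h2r0, Real.log_mul (by norm_num) (hr0 m k).ne']
  refine Real.exp_le_exp.2 ?_
  have h5 := hdbl (r m k) (hr0 m k).le
  rw [hr] at h5
  have h6 : (m₀ : ℝ) * ω (2 * r m k) ≤ m₀ * (D * (1 + (k / (m + 1) + ω 1))) := by gcongr
  have h7 : m₀ * D * (k / (m + 1)) ≤ k * Real.log 2 := by
    rw [div_le_iff₀ hlog] at hm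
    rw [mul_div_assoc', div_le_iff₀ (by positivity)]
    have : (0 : ℝ) ≤ k := by positivity
    nlinarith [mul_nonneg this hlog.le]
  linarith

end radii

/-! ### Test functions by iterated averaging -/

section avg

/-- The average of `u` over the interval `[x - a, x + a]`. -/
noncomputable def avg (a : ℝ) (u : ℝ → ℝ) (x : ℝ) : ℝ := (2 * a)⁻¹ * ∫ t in (x - a)..(x + a), u t

theorem hasDerivAt_avg (a : ℝ) {u : ℝ → ℝ} (hu : Continuous u) (x : ℝ) :
    HasDerivAt (avg a u) ((2 * a)⁻¹ * (u (x + a) - u (x - a))) x := by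
  have h1 : ∀ y, HasDerivAt (fun y => ∫ t in (0 : ℝ)..y, u t) (u y) y := fun y =>
    intervalIntegral.integral_hasDerivAt_right (hu.intervalIntegrable _ _)
      (hu.stronglyMeasurableAtFilter _ _) hu.continuousAt
  have h2 := ((h1 (x + a)).comp_add_const x a).sub ((h1 (x - a)).comp_sub_const x a)
  refine (h2.const_mul ((2 * a)⁻¹)).congr_of_eventuallyEq (Eventually.of_forall fun y => ?_)
  simp only [avg, Pi.sub_apply]
  rw [intervalIntegral.integral_interval_sub_left (hu.intervalIntegrable _ _)
    (hu.intervalIntegrable _ _)]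

theorem avg_eq_of_hasDerivAt (a : ℝ) {u u' : ℝ → ℝ} (h : ∀ x, HasDerivAt u (u' x) x)
    (hu' : Continuous u') (x : ℝ) : avg a u' x = (2 * a)⁻¹ * (u (x + a) - u (x - a)) := by
  rw [avg, intervalIntegral.integral_eq_sub_of_hasDerivAt (fun y _ => h y)
    (hu'.intervalIntegrable _ _)]

theorem abs_avg_sub_le {a : ℝ} (ha : 0 < a) {u : ℝ → ℝ} (hu : Continuous u) {x c B : ℝ}
    (h : ∀ y, |y - x| ≤ a → |u y - c| ≤ B) : |avg a u x - c| ≤ B := by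
  have h1 : avg a u x - c = (2 * a)⁻¹ * ∫ t in (x - a)..(x + a), (u t - c) := by
    rw [intervalIntegral.integral_sub (hu.intervalIntegrable _ _)
      (continuous_const.intervalIntegrable _ _), intervalIntegral.integral_const, avg, smul_eq_mul]
    field_simp
    ring
  have h2 : ‖∫ t in (x - a)..(x + a), (u t - c)‖ ≤ B * |x + a - (x - a)| := by
    refine intervalIntegral.norm_integral_le_of_norm_le_const fun y hy => ?_
    rw [Set.uIoc_of_le (by linarith)] at hy
    exact h y (abs_le.2 ⟨by linarith [hy.1], by linarith [hy.2]⟩)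
  rw [Real.norm_eq_abs, show x + a - (x - a) = 2 * a by ring,
    abs_of_pos (show 0 < 2 * a by linarith)] at h2
  rw [h1, abs_mul, abs_of_pos (inv_pos.2 (show 0 < 2 * a by linarith)), inv_mul_le_iff₀
    (by linarith)]
  linarith

/-- Iterated averages of the family `U k`, thought of as the derivatives of `U 0`. -/
noncomputable def iterAvg (a : ℕ → ℝ) (U : ℕ → ℝ → ℝ) : ℕ → ℕ → ℝ → ℝ
  | 0, k => U k
  | n + 1, k => avg (a n) (iterAvg a U n k)

variable {a : ℕ → ℝ} {U : ℕ → ℝ → ℝ} {B : ℕ → ℝ}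

theorem hasDerivAt_iterAvg (hU : ∀ k x, HasDerivAt (U k) (U (k + 1) x) x) (n k : ℕ) (x : ℝ) :
    HasDerivAt (iterAvg a U n k) (iterAvg a U n (k + 1) x) x := by
  induction n generalizing k x with
  | zero => exact hU k x
  | succ n ih =>
    have hc : ∀ k, Continuous (iterAvg a U n k) := fun k =>
      continuous_iff_continuousAt.2 fun x => (ih k x).continuousAt
    have h := hasDerivAt_avg (a n) (hc k) x
    rwa [← avg_eq_of_hasDerivAt (a n) (ih k) (hc (k + 1))] at h

theorem continuous_iterAvg (hU : ∀ k x, HasDerivAt (U k) (U (k + 1) x) x) (n k : ℕ) :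
    Continuous (iterAvg a U n k) :=
  continuous_iff_continuousAt.2 fun x => (hasDerivAt_iterAvg hU n k x).continuousAt

theorem abs_iterAvg_le (ha : ∀ i, 0 < a i) (hU : ∀ k x, HasDerivAt (U k) (U (k + 1) x) x)
    {n₀ n k : ℕ} (hn : n₀ ≤ n) {c : ℝ} (h : ∀ x, |iterAvg a U n₀ k x| ≤ c) (x : ℝ) :
    |iterAvg a U n k x| ≤ c := by
  induction n, hn using Nat.le_induction generalizing x with
  | base => exact h x
  | succ n _ ih =>
    have := abs_avg_sub_le (ha n) (continuous_iterAvg hU n k) (x := x) (c := 0) (B := c)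
      fun y _ => by simpa using ih y
    simpa [iterAvg] using this

/-- Each of the first `k` averages absorbs one derivative. -/
theorem abs_iterAvg_diag_le (ha : ∀ i, 0 < a i) (hU : ∀ k x, HasDerivAt (U k) (U (k + 1) x) x)
    (hB : ∀ k x, |U k x| ≤ B k) (k : ℕ) (x : ℝ) :
    |iterAvg a U k k x| ≤ B 0 * ∏ i ∈ Finset.range k, (a i)⁻¹ := by
  induction k generalizing x with
  | zero => simpa [iterAvg] using hB 0 x
  | succ k ih =>
    have h1 : iterAvg a U (k + 1) (k + 1) x =
        (2 * a k)⁻¹ * (iterAvg a U k k (x + a k) - iterAvg a U k k (x - a k)) :=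
      avg_eq_of_hasDerivAt (a k) (hasDerivAt_iterAvg hU k k) (continuous_iterAvg hU k (k + 1)) x
    have h2 := ih (x + a k)
    have h3 := ih (x - a k)
    have h4 := ha k
    rw [h1, abs_mul, abs_of_pos (show 0 < (2 * a k)⁻¹ by positivity), Finset.prod_range_succ,
      inv_mul_le_iff₀ (by positivity)]
    refine (abs_sub _ _).trans ((add_le_add h2 h3).trans (le_of_eq ?_))
    field_simp
    ring

theorem abs_iterAvg_succ_sub_le (ha : ∀ i, 0 < a i)
    (hU : ∀ k x, HasDerivAt (U k) (U (k + 1) x) x) (hB : ∀ k x, |U k x| ≤ B k) (n k : ℕ) (x : ℝ) :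
    |iterAvg a U (n + 1) k x - iterAvg a U n k x| ≤ B (k + 1) * a n := by
  refine abs_avg_sub_le (ha n) (continuous_iterAvg hU n k) fun y hy => ?_
  have h := Convex.norm_image_sub_le_of_norm_hasDerivWithin_le (s := Set.univ) (x := x) (y := y)
    (fun z _ => (hasDerivAt_iterAvg (a := a) hU n k z).hasDerivWithinAt)
    (fun z _ => abs_iterAvg_le ha hU (Nat.zero_le n) (hB (k + 1)) z) convex_univ (by simp)
    (by simp)
  have hB0 : 0 ≤ B (k + 1) := (abs_nonneg _).trans (hB (k + 1) 0)
  exact h.trans (by rw [Real.norm_eq_abs]; gcongr)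

theorem iterAvg_eq_const (ha : ∀ i, 0 < a i) (hU : ∀ k x, HasDerivAt (U k) (U (k + 1) x) x)
    {c : ℝ} (n : ℕ) (x : ℝ)
    (h : ∀ y, |y - x| ≤ ∑ i ∈ Finset.range n, a i → U 0 y = c) : iterAvg a U n 0 x = c := by
  induction n generalizing x with
  | zero => exact h x (by simp)
  | succ n ih =>
    have h1 : |iterAvg a U (n + 1) 0 x - c| ≤ 0 :=
      abs_avg_sub_le (ha n) (continuous_iterAvg hU n 0) fun y hy => by
        rw [ih y fun z hz => h z ?_]
        · simp
        · rw [Finset.sum_range_succ]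
          exact (abs_sub_le z y x).trans (add_le_add hz hy)
    exact sub_eq_zero.1 (abs_nonpos_iff.1 h1)

/-- The limit of the iterated averages is smooth, with the limits of the derivatives as its
derivatives. -/
theorem exists_tendsto_iterAvg (ha : ∀ i, 0 < a i) (has : Summable a)
    (hU : ∀ k x, HasDerivAt (U k) (U (k + 1) x) x) (hB : ∀ k x, |U k x| ≤ B k) :
    ∃ G : ℕ → ℝ → ℝ, (∀ k x, HasDerivAt (G k) (G (k + 1) x) x) ∧
      ∀ k x, Tendsto (fun n => iterAvg a U n k x) atTop (𝓝 (G k x)) := by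
  have hd : ∀ k x n, dist (iterAvg a U n k x) (iterAvg a U n.succ k x) ≤ B (k + 1) * a n :=
    fun k x n => by
      rw [dist_comm, Real.dist_eq]
      exact abs_iterAvg_succ_sub_le ha hU hB n k x
  have hs : ∀ k, Summable fun n => B (k + 1) * a n := fun k => has.mul_left _
  choose G hG using fun k x =>
    cauchySeq_tendsto_of_complete (cauchySeq_of_dist_le_of_summable _ (hd k x) (hs k))
  refine ⟨G, fun k => ?_, hG⟩
  refine hasDerivAt_of_tendstoUniformly (l := atTop) (f := fun n => iterAvg a U n k)
    (f' := fun n => iterAvg a U n (k + 1)) ?_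
    (Eventually.of_forall fun n x => hasDerivAt_iterAvg hU n k x) (hG k)
  rw [Metric.tendstoUniformly_iff]
  intro ε hε
  filter_upwards [(tendsto_sum_nat_add fun n => B (k + 1 + 1) * a n).eventually_lt_const hε]
    with n hn x
  rw [dist_comm]
  refine (dist_le_tsum_of_dist_le_of_tendsto _ (hd (k + 1) x) (hs (k + 1)) (hG (k + 1) x)
    n).trans_lt ?_
  simpa only [add_comm n] using hn

/-- A compactly supported function of one variable, equal to `1` near the origin, whose derivatives
`G k` are bounded by the moments of the weight. -/
theorem exists_bump (ω : Weight) :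
    ∃ (G : ℕ → ℝ → ℝ) (R : ℝ), 0 < R ∧ (∀ k x, HasDerivAt (G k) (G (k + 1) x) x) ∧
      (∀ x, |x| ≤ 1 → G 0 x = 1) ∧ (∀ x, R ≤ |x| → G 0 x = 0) ∧
      ∀ m : ℕ+, ∃ C : ℝ≥0∞, C ≠ ∞ ∧ ∀ k x, ‖G k x‖ₑ ≤ C * moment ω m k := by
  obtain ⟨a, ha, has, hab⟩ := exists_sequence ω
  set A := ∑' i, a i with hA
  have hA0 : 0 ≤ A := tsum_nonneg fun i => (ha i).le
  have hsum : ∀ n, ∑ i ∈ Finset.range n, a i ≤ A := fun n =>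
    has.sum_le_tsum _ fun i _ => (ha i).le
  let ψ : ContDiffBump (0 : ℝ) := ⟨1 + A, 2 + A, by linarith, by linarith⟩
  set U : ℕ → ℝ → ℝ := fun k => iteratedDeriv k ψ with hUdef
  have hψ : ContDiff ℝ ((⊤ : ℕ∞) : WithTop ℕ∞) ψ := ψ.contDiff
  have hU : ∀ k x, HasDerivAt (U k) (U (k + 1) x) x := fun k x => by
    simp only [hUdef, iteratedDeriv_succ]
    exact (hψ.differentiable_iteratedDeriv k (by exact_mod_cast WithTop.coe_lt_top _)
      x).hasDerivAt
  have hcs : ∀ k, HasCompactSupport (U k) := by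
    intro k
    induction k with
    | zero => simpa [hUdef] using ψ.hasCompactSupport
    | succ k ih =>
      simp only [hUdef, iteratedDeriv_succ] at ih ⊢
      exact ih.deriv
  have hbd : ∀ k, ∃ C, ∀ x, |U k x| ≤ C := fun k =>
    (hcs k).exists_bound_of_continuous
      (continuous_iff_continuousAt.2 fun x => (hU k x).continuousAt)
  choose B hB using hbd
  obtain ⟨G, hG, hGt⟩ := exists_tendsto_iterAvg ha has hU hB
  have hconst : ∀ c x, (∀ y, |y - x| ≤ A → U 0 y = c) → G 0 x = c := fun c x h => by
    refine tendsto_nhds_unique (hGt 0 x) ?_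
    rw [show (fun n => iterAvg a U n 0 x) = fun _ => c from
      funext fun n => iterAvg_eq_const ha hU n x fun y hy => h y (hy.trans (hsum n))]
    exact tendsto_const_nhds
  have hU0 : U 0 = ψ := iteratedDeriv_zero
  refine ⟨G, 2 + 2 * A, by linarith, hG, fun x hx => hconst 1 x fun y hy => ?_,
    fun x hx => hconst 0 x fun y hy => ?_, fun m => ?_⟩
  · rw [hU0]
    refine ψ.one_of_mem_closedBall ?_
    rw [mem_closedBall_zero_iff, Real.norm_eq_abs]
    have := abs_sub_abs_le_abs_sub y x
    change |y| ≤ 1 + A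
    linarith
  · rw [hU0]
    refine ψ.zero_of_le_dist ?_
    rw [dist_zero_right, Real.norm_eq_abs]
    have := abs_sub_abs_le_abs_sub x y
    rw [abs_sub_comm] at this
    change 2 + A ≤ |y|
    linarith
  · obtain ⟨C, hC, h⟩ := hab m
    have hB0 : 0 ≤ B 0 := (abs_nonneg _).trans (hB 0 0)
    refine ⟨ENNReal.ofReal (B 0) * C, ENNReal.mul_ne_top ENNReal.ofReal_ne_top hC,
      fun k x => ?_⟩
    have h1 : |G k x| ≤ B 0 * ∏ i ∈ Finset.range k, (a i)⁻¹ :=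
      le_of_tendsto (hGt k x).abs <| (eventually_ge_atTop k).mono fun n hn =>
        abs_iterAvg_le ha hU hn (abs_iterAvg_diag_le ha hU hB k) x
    rw [Real.enorm_eq_ofReal_abs, mul_assoc]
    refine (ENNReal.ofReal_le_ofReal h1).trans ?_
    rw [ENNReal.ofReal_mul hB0]
    gcongr
    exact h k

end avg

/-! ### Cutoff functions -/

section cutoff

variable {N : ℕ}

theorem eq_sum_smul_single (x : Rn N) : x = ∑ i, x i • EuclideanSpace.single i (1 : ℝ) := by
  ext j
  simp [Finset.sum_apply, Pi.single_apply]

theorem norm_le_of_forall_abs_le {x : Rn N} {c : ℝ} (h : ∀ i, |x i| ≤ c) : ‖x‖ ≤ N * c := by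
  calc ‖x‖ ≤ ∑ i, ‖x i • EuclideanSpace.single i (1 : ℝ)‖ := by
        conv_lhs => rw [eq_sum_smul_single x]
        exact norm_sum_le _ _
    _ ≤ ∑ _i : Fin N, c := by
        refine Finset.sum_le_sum fun i _ => ?_
        rw [norm_smul]
        simpa using h i
    _ = N * c := by simp

theorem enorm_le_sum (x : Rn N) : ‖x‖ₑ ≤ ∑ i, ‖x i‖ₑ := by
  conv_lhs => rw [eq_sum_smul_single x]
  refine (enorm_sum_le _ _).trans (Finset.sum_le_sum fun i _ => ?_)
  rw [enorm_smul]
  simp [enorm_eq_nnnorm]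

theorem enorm_coord_le (x : Rn N) (i : Fin N) : ‖x i‖ₑ ≤ ‖x‖ₑ :=
  enorm_le_iff_norm_le.2 (PiLp.norm_apply_le x i)

/-- Bounds by moments are stable under products, at the cost of changing the parameter `m`. -/
theorem exists_enorm_dlist_mul_le (ω : Weight) (N : ℕ) (m : ℕ+) :
    ∃ (m' : ℕ+) (C : ℝ≥0∞), m ≤ m' ∧ C ≠ ∞ ∧
      ∀ {f g : Rn N → ℂ} (_ : f ∈ Smooth N) (_ : g ∈ Smooth N) {A B : ℝ≥0∞} {x : Rn N}
        (_ : ∀ l : List (Fin N), ‖dlist l f x‖ₑ ≤ A * moment ω m' l.length)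
        (_ : ∀ l : List (Fin N), ‖dlist l g x‖ₑ ≤ B * moment ω m' l.length)
        (l : List (Fin N)), ‖dlist l (f * g) x‖ₑ ≤ C * A * B * moment ω m l.length := by
  obtain ⟨m', C, hm, hC, h⟩ := exists_two_pow_mul_moment_le ω m
  refine ⟨m', C, hm, hC, fun {f g} hf hg {A B x} hA hB l => ?_⟩
  have h1 := enorm_dlist_mul_le (M := moment ω m') (fun j k => moment_mul_le (by positivity) j k)
    l hf hg 0 0 (by simpa using hA) (by simpa using hB)
  simp only [add_zero, zero_add] at h1
  calc _ ≤ _ := h1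
    _ ≤ A * B * (C * moment ω m l.length) := mul_le_mul_right (h _) _
    _ = _ := by ring

theorem one_mem_smooth : (1 : Rn N → ℂ) ∈ Smooth N :=
  mem_smooth_of_contDiff contDiff_const

theorem exists_enorm_dlist_one_le (ω : Weight) (N : ℕ) (m : ℕ+) :
    ∃ C : ℝ≥0∞, C ≠ ∞ ∧ ∀ (l : List (Fin N)) (x : Rn N),
      ‖dlist l (1 : Rn N → ℂ) x‖ₑ ≤ C * moment ω m l.length := by
  refine ⟨(moment ω m 0)⁻¹, ENNReal.inv_ne_top.2 (moment_ne_zero 0), fun l x => ?_⟩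
  cases l using List.reverseRecOn with
  | nil =>
    have h := moment_zero_le (ω := ω) (m := m) (by positivity)
    rw [List.length_nil, ENNReal.inv_mul_cancel (moment_ne_zero 0) (h.trans_lt (by simp)).ne]
    simp
  | append_singleton l i =>
    have : pderiv i (1 : Rn N → ℂ) = 0 := by
      ext x
      rw [pderiv, show (1 : Rn N → ℂ) = fun _ => 1 from rfl, fderiv_const_apply]
      rfl
    rw [dlist_concat, this, dlist_zero]
    simp

/-- The dilated one-variable function `x ↦ G k (x i / (n + 1))`, with the factor that it acquires
as a `k`-th derivative. -/
noncomputable def dilation (G : ℕ → ℝ → ℝ) (n : ℕ) (i : Fin N) (k : ℕ) : Rn N → ℂ :=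
  fun x => ((((n : ℝ) + 1)⁻¹ ^ k * G k (((n : ℝ) + 1)⁻¹ * x i) : ℝ) : ℂ)

theorem dilation_mem_smooth {G : ℕ → ℝ → ℝ} (hG : ∀ k x, HasDerivAt (G k) (G (k + 1) x) x)
    (n : ℕ) (i : Fin N) (k : ℕ) : dilation G n i k ∈ Smooth N := by
  have hit : ∀ j, iteratedDeriv j (G k) = G (k + j) := by
    intro j
    induction j with
    | zero => simp
    | succ j ih => rw [iteratedDeriv_succ, ih, ← add_assoc]; exact funext fun x => (hG _ x).deriv
  have hs : ContDiff ℝ ((⊤ : ℕ∞) : WithTop ℕ∞) (G k) :=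
    contDiff_of_differentiable_iteratedDeriv fun j _ => by
      rw [hit]
      exact fun x => (hG _ x).differentiableAt
  refine mem_smooth_of_contDiff (Complex.ofRealCLM.contDiff.comp ?_)
  exact contDiff_const.mul (hs.comp (contDiff_const.mul
    (EuclideanSpace.proj (𝕜 := ℝ) i).contDiff))

theorem pderiv_dilation {G : ℕ → ℝ → ℝ} (hG : ∀ k x, HasDerivAt (G k) (G (k + 1) x) x)
    (n : ℕ) (i j : Fin N) (k : ℕ) :
    pderiv j (dilation G n i k) = if j = i then dilation G n i (k + 1) else 0 := by
  ext x
  have h1 : HasFDerivAt (fun x : Rn N => ((n : ℝ) + 1)⁻¹ * x i)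
      (((n : ℝ) + 1)⁻¹ • EuclideanSpace.proj (𝕜 := ℝ) i) x :=
    (EuclideanSpace.proj (𝕜 := ℝ) i).hasFDerivAt.const_mul _
  have h2 := ((hG k (((n : ℝ) + 1)⁻¹ * x i)).comp_hasFDerivAt x h1).const_mul
    (((n : ℝ) + 1)⁻¹ ^ k)
  have h3 : HasFDerivAt (dilation G n i k) _ x := Complex.ofRealCLM.hasFDerivAt.comp x h2
  rw [pderiv, h3.fderiv]
  by_cases h : j = i
  · subst h
    simp only [dilation, if_true]
    generalize ((n : ℝ) + 1)⁻¹ = c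
    simp
    ring
  · simp [h, Ne.symm h]

theorem enorm_dlist_dilation_le {G : ℕ → ℝ → ℝ} (hG : ∀ k x, HasDerivAt (G k) (G (k + 1) x) x)
    {b : ℕ → ℝ≥0∞} (hb : ∀ k x, ‖G k x‖ₑ ≤ b k) (n : ℕ) (i : Fin N) (x : Rn N)
    (l : List (Fin N)) (k : ℕ) : ‖dlist l (dilation G n i k) x‖ₑ ≤ b (k + l.length) := by
  induction l using List.reverseRecOn generalizing k with
  | nil =>
    have h1 : ‖((n : ℝ) + 1)⁻¹ ^ k * G k (((n : ℝ) + 1)⁻¹ * x i)‖ ≤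
        ‖G k (((n : ℝ) + 1)⁻¹ * x i)‖ := by
      rw [norm_mul]
      refine mul_le_of_le_one_left (norm_nonneg _) ?_
      rw [Real.norm_eq_abs, abs_of_nonneg (by positivity)]
      refine pow_le_one₀ (by positivity) (inv_le_one_of_one_le₀ ?_)
      linarith [(Nat.cast_nonneg n : (0 : ℝ) ≤ n)]
    refine le_trans (enorm_le_iff_norm_le.2 ?_) (hb k (((n : ℝ) + 1)⁻¹ * x i))
    rw [dlist_nil, dilation, Complex.norm_real]
    exact h1
  | append_singleton l j ih =>
    rw [dlist_concat, pderiv_dilation hG, List.length_append, List.length_singleton,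
      add_comm l.length, ← add_assoc]
    split_ifs
    · exact ih (k + 1)
    · simp [dlist_zero]

theorem prod_mem_smooth {ι : Type*} {f : ι → Rn N → ℂ} (hf : ∀ i, f i ∈ Smooth N) (t : Finset ι) :
    ∏ i ∈ t, f i ∈ Smooth N := by
  classical
  induction t using Finset.induction_on with
  | empty => simpa using one_mem_smooth
  | insert a t ha ih => rw [Finset.prod_insert ha]; exact mul_mem_smooth (hf a) ih

theorem exists_enorm_dlist_prod_le (ω : Weight) {ι κ : Type*} {f : κ → ι → Rn N → ℂ}
    (hf : ∀ n i, f n i ∈ Smooth N)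
    (hb : ∀ m : ℕ+, ∃ C : ℝ≥0∞, C ≠ ∞ ∧ ∀ n i l x, ‖dlist l (f n i) x‖ₑ ≤
      C * moment ω m l.length) (t : Finset ι) :
    ∀ m : ℕ+, ∃ C : ℝ≥0∞, C ≠ ∞ ∧ ∀ n l x, ‖dlist l (∏ i ∈ t, f n i) x‖ₑ ≤
      C * moment ω m l.length := by
  classical
  induction t using Finset.induction_on with
  | empty =>
    intro m
    obtain ⟨C, hC, h⟩ := exists_enorm_dlist_one_le ω N m
    exact ⟨C, hC, fun n l x => by simpa using h l x⟩
  | insert a t ha ih =>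
    intro m
    obtain ⟨m', C, -, hC, h⟩ := exists_enorm_dlist_mul_le ω N m
    obtain ⟨C₁, hC₁, h₁⟩ := hb m'
    obtain ⟨C₂, hC₂, h₂⟩ := ih m'
    refine ⟨C * C₁ * C₂, ENNReal.mul_ne_top (ENNReal.mul_ne_top hC hC₁) hC₂, fun n l x => ?_⟩
    rw [Finset.prod_insert ha]
    exact h (hf n a) (prod_mem_smooth (hf n) t) (fun l => h₁ n a l x) (fun l => h₂ n l x) l

/-- A sequence of cutoff functions `χ n`, equal to `1` on the ball of radius `n + 1`, whose
derivatives are bounded by the moments of the weight uniformly in `n`. -/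
structure IsCutoff (ω : Weight) (χ : ℕ → Rn N → ℂ) : Prop where
  smooth : ∀ n, χ n ∈ Smooth N
  hasCompactSupport : ∀ n, HasCompactSupport (χ n)
  eq_one : ∀ (n : ℕ) (x : Rn N), ‖x‖ < n + 1 → χ n x = 1
  bound : ∀ m : ℕ+, ∃ C : ℝ≥0∞, C ≠ ∞ ∧ ∀ n l x, ‖dlist l (χ n) x‖ₑ ≤ C * moment ω m l.length

theorem exists_isCutoff (ω : Weight) (N : ℕ) : ∃ χ : ℕ → Rn N → ℂ, IsCutoff ω χ := by
  obtain ⟨G, R, hR, hG, hG1, hG0, hGb⟩ := exists_bump ω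
  refine ⟨fun n => ∏ i, dilation G n i 0, fun n => prod_mem_smooth
    (fun i => dilation_mem_smooth hG n i 0) _, fun n => ?_, fun n x hx => ?_, ?_⟩
  · refine HasCompactSupport.intro
      (isCompact_closedBall (0 : Rn N) (N * (((n : ℝ) + 1) * R))) fun x hx => ?_
    have hex : ∃ i, ((n : ℝ) + 1) * R < |x i| := by
      by_contra! hcon
      exact hx (mem_closedBall_zero_iff.2 (norm_le_of_forall_abs_le hcon))
    obtain ⟨i, hi⟩ := hex
    change (∏ i, dilation G n i 0) x = 0
    rw [Finset.prod_apply]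
    refine Finset.prod_eq_zero (Finset.mem_univ i) ?_
    have hn : (0 : ℝ) < (n : ℝ) + 1 := by positivity
    rw [dilation, hG0 _ ?_]
    · simp
    · rw [abs_mul, abs_of_pos (inv_pos.2 hn), le_inv_mul_iff₀ hn]
      exact hi.le
  · rw [Finset.prod_apply]
    refine Finset.prod_eq_one fun i _ => ?_
    have hn : (0 : ℝ) < (n : ℝ) + 1 := by positivity
    rw [dilation, hG1 _ ?_]
    · simp
    · rw [abs_mul, abs_of_pos (inv_pos.2 hn), inv_mul_le_iff₀ hn, mul_one]
      exact (PiLp.norm_apply_le x i).trans hx.le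
  · refine exists_enorm_dlist_prod_le ω (fun n i => dilation_mem_smooth hG n i 0)
      (fun m => ?_) _
    obtain ⟨C, hC, h⟩ := hGb m
    exact ⟨C, hC, fun n i l x => by
      simpa using enorm_dlist_dilation_le hG (b := fun k => C * moment ω m k) h n i x l 0⟩

end cutoff

/-! ### The Fourier transform of rapidly decreasing functions -/

section fourier

variable {N : ℕ}

/-- Continuous functions decreasing faster than every power of `‖x‖`. -/
def RapidDecay (f : Rn N → ℂ) : Prop :=
  Continuous f ∧ ∀ L : ℕ, ∃ A : ℝ≥0∞, A ≠ ∞ ∧ ∀ x, (1 + ‖x‖ₑ) ^ L * ‖f x‖ₑ ≤ A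

theorem one_add_enorm_pow_ne_zero (x : Rn N) (L : ℕ) : (1 + ‖x‖ₑ) ^ L ≠ 0 :=
  pow_ne_zero _ (by simp)

theorem one_add_enorm_pow_ne_top (x : Rn N) (L : ℕ) : (1 + ‖x‖ₑ) ^ L ≠ ∞ :=
  ENNReal.pow_ne_top (by simp)

theorem one_add_enorm_eq (x : Rn N) : 1 + ‖x‖ₑ = ENNReal.ofReal (1 + ‖x‖) := by
  rw [ENNReal.ofReal_add zero_le_one (norm_nonneg _), ENNReal.ofReal_one, ofReal_norm]

/-- The integral of `(1 + ‖x‖) ^ (-(N + 1))` over `ℝ ^ N`. -/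
noncomputable def weightIntegral (N : ℕ) : ℝ≥0∞ := ∫⁻ x : Rn N, ((1 + ‖x‖ₑ) ^ (N + 1))⁻¹

theorem weightIntegral_ne_top (N : ℕ) : weightIntegral N ≠ ∞ := by
  have h := finite_integral_one_add_norm (E := Rn N) (μ := volume) (r := ((N + 1 : ℕ) : ℝ))
    (by simp)
  refine (lt_of_le_of_lt (le_of_eq (lintegral_congr fun x => ?_)) h).ne
  have h0 : 0 < 1 + ‖x‖ := by positivity
  rw [one_add_enorm_eq, ← ENNReal.ofReal_pow h0.le, ← ENNReal.ofReal_inv_of_pos (by positivity),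
    Real.rpow_neg h0.le, Real.rpow_natCast]

theorem lintegral_le_mul_weightIntegral {φ : Rn N → ℝ≥0∞} {A : ℝ≥0∞}
    (h : ∀ x, (1 + ‖x‖ₑ) ^ (N + 1) * φ x ≤ A) : ∫⁻ x, φ x ≤ A * weightIntegral N := by
  rw [weightIntegral, ← lintegral_const_mul _ (by fun_prop)]
  refine lintegral_mono fun x => ?_
  rw [← div_eq_mul_inv, ENNReal.le_div_iff_mul_le
    (Or.inl (one_add_enorm_pow_ne_zero x _)) (Or.inl (one_add_enorm_pow_ne_top x _)), mul_comm]
  exact h x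

theorem RapidDecay.integrable_pow_mul {f : Rn N → ℂ} (hf : RapidDecay f) (n : ℕ) :
    Integrable fun x => ‖x‖ ^ n * ‖f x‖ := by
  obtain ⟨A, hA, h⟩ := hf.2 (N + 1 + n)
  have hc := hf.1
  refine ⟨Continuous.aestronglyMeasurable (by fun_prop), lt_of_le_of_lt
    (lintegral_le_mul_weightIntegral (A := A) fun x => ?_)
    (ENNReal.mul_ne_top hA (weightIntegral_ne_top N)).lt_top⟩
  refine le_trans ?_ (h x)
  rw [enorm_mul, enorm_pow, enorm_norm, enorm_norm, pow_add _ (N + 1) n, mul_assoc]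
  gcongr
  simp

theorem RapidDecay.integrable {f : Rn N → ℂ} (hf : RapidDecay f) : Integrable f := by
  have := hf.integrable_pow_mul 0
  simp only [pow_zero, one_mul] at this
  exact (integrable_norm_iff hf.1.aestronglyMeasurable).1 this

theorem RapidDecay.coordMul {f : Rn N → ℂ} (hf : RapidDecay f) (i : Fin N) :
    RapidDecay (coordMul i f) := by
  have hc := hf.1
  refine ⟨(continuous_of_mem_smooth (coord_mem_smooth i)).mul hc, fun L => ?_⟩
  obtain ⟨A, hA, h⟩ := hf.2 (L + 1)
  refine ⟨A, hA, fun x => le_trans ?_ (h x)⟩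
  rw [BeurlingSpaces.coordMul, enorm_mul, pow_succ, mul_assoc]
  have h1 : ‖((x i : ℝ) : ℂ)‖ₑ ≤ 1 + ‖x‖ₑ := by
    refine le_trans ?_ ((enorm_coord_le x i).trans le_add_self)
    exact enorm_le_iff_norm_le.2 (by simp)
  gcongr

/-- Multiplication by the monomial `x_{i₁} ⋯ x_{i_k}`. -/
def monomialMul (l : List (Fin N)) (f : Rn N → ℂ) : Rn N → ℂ := l.foldr coordMul f

theorem monomialMul_cons (i : Fin N) (l : List (Fin N)) (f : Rn N → ℂ) :
    monomialMul (i :: l) f = coordMul i (monomialMul l f) := rfl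

theorem RapidDecay.monomialMul {f : Rn N → ℂ} (hf : RapidDecay f) (l : List (Fin N)) :
    RapidDecay (monomialMul l f) := by
  induction l with
  | nil => exact hf
  | cons i l ih => exact ih.coordMul i

theorem enorm_monomialMul_le (l : List (Fin N)) (f : Rn N → ℂ) (x : Rn N) :
    ‖monomialMul l f x‖ₑ ≤ ‖x‖ₑ ^ l.length * ‖f x‖ₑ := by
  induction l with
  | nil => simp [monomialMul]
  | cons i l ih =>
    rw [monomialMul_cons, coordMul, enorm_mul, List.length_cons, pow_succ', mul_assoc]
    have h1 : ‖((x i : ℝ) : ℂ)‖ₑ ≤ ‖x‖ₑ :=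
      le_trans (enorm_le_iff_norm_le.2 (by simp)) (enorm_coord_le x i)
    gcongr

/-- The bilinear form for which Mathlib's `VectorFourier.fourierIntegral` is the Fourier transform
without the factor `2π` in the exponent. -/
noncomputable def fourierForm (N : ℕ) : Rn N →L[ℝ] Rn N →L[ℝ] ℝ := (2 * Real.pi)⁻¹ • innerSL ℝ

theorem fourier_eq_fourierIntegral (f : Rn N → ℂ) :
    fourier f = VectorFourier.fourierIntegral Real.fourierChar volume
      (fourierForm N).toLinearMap₁₂ f := by
  ext ξ
  rw [fourier, VectorFourier.fourierIntegral]
  refine integral_congr_ae (Eventually.of_forall fun x => ?_)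
  have h1 : (fourierForm N).toLinearMap₁₂ x ξ = (2 * Real.pi)⁻¹ * inner ℝ x ξ := rfl
  simp only [h1, Circle.smul_def, Real.fourierChar_apply, smul_eq_mul]
  rw [mul_comm]
  congr 2
  have := Real.pi_ne_zero
  push_cast
  field_simp

theorem RapidDecay.fourier_mem_smooth {f : Rn N → ℂ} (hf : RapidDecay f) :
    fourier f ∈ Smooth N := by
  rw [fourier_eq_fourierIntegral]
  exact mem_smooth_of_contDiff
    (VectorFourier.contDiff_fourierIntegral _ fun n _ => hf.integrable_pow_mul n)

theorem RapidDecay.pderiv_fourier {f : Rn N → ℂ} (hf : RapidDecay f) (i : Fin N) :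
    pderiv i (fourier f) = (-Complex.I) • fourier (BeurlingSpaces.coordMul i f) := by
  ext ξ
  have h1 := hf.integrable_pow_mul 1
  simp only [pow_one] at h1
  have hi : Integrable (VectorFourier.fourierSMulRight (fourierForm N) f) :=
    ((h1.const_mul (2 * Real.pi * ‖fourierForm N‖))).mono'
      (hf.1.aestronglyMeasurable.fourierSMulRight) (Eventually.of_forall fun v => by
        simpa only [mul_assoc] using VectorFourier.norm_fourierSMulRight_le (fourierForm N) f v)
  rw [pderiv, fourier_eq_fourierIntegral f,
    (VectorFourier.hasFDerivAt_fourierIntegral _ hf.integrable h1 ξ).fderiv,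
    Real.fourierIntegral_continuousLinearMap_apply' hi, ← fourier_eq_fourierIntegral,
    ← fourier_smul]
  congr 1
  ext x
  have h2 : fourierForm N x (EuclideanSpace.single i 1) = (2 * Real.pi)⁻¹ * x i := by
    have h3 : fourierForm N x (EuclideanSpace.single i 1) =
      (2 * Real.pi)⁻¹ * inner ℝ x (EuclideanSpace.single i (1 : ℝ)) := rfl
    rw [h3, EuclideanSpace.inner_single_right]
    simp
  rw [VectorFourier.fourierSMulRight_apply, h2, Pi.smul_apply, BeurlingSpaces.coordMul]
  have := Real.pi_ne_zero
  simp only [smul_eq_mul, Complex.real_smul]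
  push_cast
  field_simp

theorem RapidDecay.dlist_fourier {f : Rn N → ℂ} (hf : RapidDecay f) (l : List (Fin N)) :
    dlist l (fourier f) = (-Complex.I) ^ l.length • fourier (BeurlingSpaces.monomialMul l f) := by
  induction l with
  | nil => simp [BeurlingSpaces.monomialMul]
  | cons i l ih =>
    rw [dlist_cons, ih, pderiv_smul i _ (hf.monomialMul l).fourier_mem_smooth,
      (hf.monomialMul l).pderiv_fourier, smul_smul, List.length_cons, pow_succ, monomialMul_cons]

theorem enorm_fourier_le (f : Rn N → ℂ) (ξ : Rn N) : ‖fourier f ξ‖ₑ ≤ ∫⁻ x, ‖f x‖ₑ := by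
  refine (enorm_integral_le_lintegral_enorm _).trans (le_of_eq (lintegral_congr fun x => ?_))
  rw [enorm_mul]
  have : ‖Complex.exp (-Complex.I * (inner ℝ x ξ : ℝ))‖ₑ = 1 := by
    rw [← ofReal_norm, Complex.norm_exp]
    simp
  rw [this, mul_one]

theorem RapidDecay.fourier_pderiv {f : Rn N → ℂ} (hfs : f ∈ Smooth N) (hf : RapidDecay f)
    (i : Fin N) (hf' : RapidDecay (pderiv i f)) (ξ : Rn N) :
    fourier (pderiv i f) ξ = Complex.I * ξ i * fourier f ξ := by
  set e : Rn N → ℂ := fun x => Complex.exp (-Complex.I * (inner ℝ x ξ : ℝ)) with he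
  have hde : ∀ x, HasFDerivAt e (e x • (-Complex.I) •
      (Complex.ofRealCLM.comp ((innerSL ℝ).flip ξ))) x := by
    intro x
    have h1 : HasFDerivAt (fun x : Rn N => ((inner ℝ x ξ : ℝ) : ℂ))
      (Complex.ofRealCLM.comp ((innerSL ℝ).flip ξ)) x :=
      (Complex.ofRealCLM.comp ((innerSL ℝ).flip ξ)).hasFDerivAt
    exact (h1.const_mul (-Complex.I)).cexp
  have hde' : ∀ x, fderiv ℝ e x (EuclideanSpace.single i 1) = -(Complex.I * ξ i) * e x := by
    intro x
    rw [(hde x).fderiv]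
    have : (innerSL ℝ).flip ξ (EuclideanSpace.single i (1 : ℝ)) = ξ i := by
      have h3 : (innerSL ℝ).flip ξ (EuclideanSpace.single i (1 : ℝ)) =
        inner ℝ (EuclideanSpace.single i (1 : ℝ)) ξ := rfl
      rw [h3, EuclideanSpace.inner_single_left]
      simp
    simp only [smul_apply, ContinuousLinearMap.comp_apply, this,
      Complex.ofRealCLM_apply, smul_eq_mul]
    ring
  have h2 := integral_mul_fderiv_eq_neg_fderiv_mul_of_integrable (μ := volume) (f := f) (g := e)
    (v := EuclideanSpace.single i 1) (fourier_integrable hf'.integrable ξ)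
    (by
      simp_rw [hde']
      refine ((fourier_integrable hf.integrable ξ).const_mul (-(Complex.I * ξ i))).congr
        (Eventually.of_forall fun x => ?_)
      simp only [he]
      ring)
    (fourier_integrable hf.integrable ξ) (fun x _ => differentiable_of_mem_smooth hfs x)
    (fun x _ => (hde x).differentiableAt)
  have h3 : fourier (pderiv i f) ξ =
    ∫ x, fderiv ℝ f x (EuclideanSpace.single i 1) * e x := rfl
  rw [h3, ← neg_eq_iff_eq_neg.2 h2, ← integral_neg, fourier, ← integral_const_mul]
  refine integral_congr_ae (Eventually.of_forall fun x => ?_)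
  simp only [hde']
  simp only [he]
  ring

theorem fourier_neg (f : Rn N → ℂ) (ξ : Rn N) :
    fourier f (-ξ) = fourier (fun x => f (-x)) ξ := by
  rw [fourier, fourier, ← integral_neg_eq_self]
  simp

/-- The Fourier inversion formula. -/
theorem exists_fourier_inversion (N : ℕ) : ∃ c : ℂ, ∀ f : Rn N → ℂ, Continuous f →
    Integrable f → Integrable (fourier f) → f = c • fourier fun ξ => fourier f (-ξ) := by
  have hpi : (0 : ℝ) < 2 * Real.pi := by positivity
  refine ⟨(|((2 * Real.pi) ^ N)⁻¹| : ℝ), fun f hc hf hf' => ?_⟩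
  have h1 : ∀ ξ, FourierTransform.fourier f ξ = fourier f ((2 * Real.pi) • ξ) := by
    intro ξ
    rw [Real.fourier_eq', fourier]
    refine integral_congr_ae (Eventually.of_forall fun x => ?_)
    simp only [inner_smul_right, smul_eq_mul]
    rw [mul_comm]
    congr 2
    push_cast
    ring
  have h2 : Integrable (FourierTransform.fourier f) := by
    rw [show FourierTransform.fourier f = fun ξ => fourier f ((2 * Real.pi) • ξ) from funext h1]
    exact hf'.comp_smul hpi.ne'
  have h3 := hc.fourierInv_fourier_eq hf h2
  ext x
  conv_lhs => rw [← h3]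
  rw [Real.fourierInv_eq', Pi.smul_apply, ← fourier_neg, fourier]
  have h4 := Measure.integral_comp_smul (volume : Measure (Rn N))
    (fun ξ => fourier f ξ * Complex.exp (-Complex.I * (inner ℝ ξ (-x) : ℝ))) (2 * Real.pi)
  rw [finrank_euclideanSpace, Fintype.card_fin] at h4
  rw [smul_eq_mul, ← Complex.real_smul, ← h4]
  refine integral_congr_ae (Eventually.of_forall fun ξ => ?_)
  simp only [h1, inner_smul_left, inner_neg_right, smul_eq_mul]
  rw [mul_comm]
  congr 2
  simp
  ring

end fourier

/-! ### Decay conditions on a function and on its Fourier transform -/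

section decay

variable {N : ℕ} {ω : Weight}

/-- The exponential factor `exp(c ω(x))` with values in `[0, ∞]`. -/
noncomputable def expWeight (ω : Weight) (c : ℝ) (x : Rn N) : ℝ≥0∞ :=
  ENNReal.ofReal (Real.exp (c * ω ‖x‖))

theorem expWeight_mono {c d : ℝ} (h : c ≤ d) (x : Rn N) : expWeight ω c x ≤ expWeight ω d x := by
  have := ω.nonneg ‖x‖ (norm_nonneg _)
  rw [expWeight, expWeight]
  gcongr

theorem expWeight_add (c d : ℝ) (x : Rn N) :
    expWeight ω (c + d) x = expWeight ω c x * expWeight ω d x := by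
  rw [expWeight, expWeight, expWeight, ← ENNReal.ofReal_mul (Real.exp_pos _).le, ← Real.exp_add,
    add_mul]

theorem one_le_expWeight {c : ℝ} (hc : 0 ≤ c) (x : Rn N) : 1 ≤ expWeight ω c x := by
  have := mul_nonneg hc (ω.nonneg ‖x‖ (norm_nonneg _))
  rw [expWeight, ENNReal.one_le_ofReal]
  exact Real.one_le_exp this

theorem exists_one_add_enorm_pow_le (ω : Weight) (N p : ℕ) :
    ∃ (n : ℕ+) (C : ℝ≥0∞), C ≠ ∞ ∧ ∀ x : Rn N, (1 + ‖x‖ₑ) ^ p ≤ C * expWeight ω n x := by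
  obtain ⟨l, C, hC, h⟩ := ω.exists_pow_le p
  refine ⟨l, ENNReal.ofReal C, ENNReal.ofReal_ne_top, fun x => ?_⟩
  rw [one_add_enorm_eq, ← ENNReal.ofReal_pow (by positivity), expWeight,
    ← ENNReal.ofReal_mul hC.le]
  exact ENNReal.ofReal_le_ofReal (h _ (norm_nonneg _))

/-- Smooth functions all of whose derivatives decrease faster than `exp(-n ω)` for all `n`. -/
def ExpDecay (ω : Weight) (f : Rn N → ℂ) : Prop :=
  f ∈ Smooth N ∧ ∀ (n : ℕ+) (l : List (Fin N)), ∃ C : ℝ≥0∞, C ≠ ∞ ∧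
    ∀ x, expWeight ω n x * ‖dlist l f x‖ₑ ≤ C

theorem ExpDecay.pderiv {f : Rn N → ℂ} (hf : ExpDecay ω f) (i : Fin N) :
    ExpDecay ω (pderiv i f) :=
  ⟨pderiv_mem i hf.1, fun n l => by
    obtain ⟨C, hC, h⟩ := hf.2 n (l ++ [i])
    exact ⟨C, hC, fun x => by rw [← dlist_concat]; exact h x⟩⟩

theorem ExpDecay.smul {f : Rn N → ℂ} (hf : ExpDecay ω f) (c : ℂ) : ExpDecay ω (c • f) :=
  ⟨Submodule.smul_mem _ c hf.1, fun n l => by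
    obtain ⟨C, hC, h⟩ := hf.2 n l
    refine ⟨‖c‖ₑ * C, ENNReal.mul_ne_top (by simp) hC, fun x => ?_⟩
    rw [dlist_smul l c hf.1, Pi.smul_apply, enorm_smul, mul_left_comm]
    gcongr
    exact h x⟩

theorem ExpDecay.rapidDecay {f : Rn N → ℂ} (hf : ExpDecay ω f) : RapidDecay f := by
  refine ⟨continuous_of_mem_smooth hf.1, fun L => ?_⟩
  obtain ⟨n, C, hC, h⟩ := exists_one_add_enorm_pow_le ω N L
  obtain ⟨C', hC', h'⟩ := hf.2 n []
  refine ⟨C * C', ENNReal.mul_ne_top hC hC', fun x => ?_⟩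
  calc _ ≤ C * expWeight ω n x * ‖f x‖ₑ := by gcongr; exact h x
    _ = C * (expWeight ω n x * ‖f x‖ₑ) := mul_assoc _ _ _
    _ ≤ _ := by gcongr; exact h' x

theorem ExpDecay.coordMul {f : Rn N → ℂ} (hf : ExpDecay ω f) (i : Fin N) :
    ExpDecay ω (coordMul i f) := by
  refine ⟨coordMul_mem_smooth i hf.1, fun n l => ?_⟩
  induction l using List.reverseRecOn generalizing f with
  | nil =>
    obtain ⟨n', C, hC, h⟩ := exists_one_add_enorm_pow_le ω N 1
    obtain ⟨C', hC', h'⟩ := hf.2 (n + n') []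
    refine ⟨C * C', ENNReal.mul_ne_top hC hC', fun x => ?_⟩
    have h1 : ‖((x i : ℝ) : ℂ)‖ₑ ≤ C * expWeight ω n' x := by
      refine le_trans ?_ (h x)
      rw [pow_one]
      exact (le_trans (enorm_le_iff_norm_le.2 (by simp)) (enorm_coord_le x i)).trans le_add_self
    have h2 := h' x
    rw [PNat.add_coe, Nat.cast_add, expWeight_add] at h2
    rw [dlist_nil, BeurlingSpaces.coordMul, enorm_mul]
    calc _ ≤ expWeight ω n x * ((C * expWeight ω n' x) * ‖f x‖ₑ) := by gcongr
      _ = C * (expWeight ω n x * expWeight ω n' x * ‖dlist [] f x‖ₑ) := by rw [dlist_nil]; ring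
      _ ≤ _ := by gcongr
  | append_singleton l j ih =>
    obtain ⟨C, hC, h⟩ := ih (hf.pderiv j)
    obtain ⟨C', hC', h'⟩ := hf.2 n l
    refine ⟨C' + C, ENNReal.add_ne_top.2 ⟨hC', hC⟩, fun x => ?_⟩
    have h0 : (if j = i then f else 0) ∈ Smooth N := by
      split_ifs
      exacts [hf.1, zero_mem _]
    have h1 : ‖dlist l (if j = i then f else 0) x‖ₑ ≤ ‖dlist l f x‖ₑ := by
      split_ifs
      · exact le_rfl
      · simp [dlist_zero]
    rw [dlist_concat, pderiv_coordMul i j hf.1,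
      dlist_add l h0 (coordMul_mem_smooth i (pderiv_mem j hf.1)), Pi.add_apply]
    calc _ ≤ expWeight ω n x * (‖dlist l f x‖ₑ +
            ‖dlist l (BeurlingSpaces.coordMul i (BeurlingSpaces.pderiv j f)) x‖ₑ) := by
          gcongr
          exact (enorm_add_le _ _).trans (by gcongr)
      _ ≤ _ := by
          rw [mul_add]
          exact add_le_add (h' x) (h x)

theorem s_le_iff {lam : ℝ} {α : MultiIndex N} {f : Rn N → ℂ} {C : ℝ≥0∞} :
    s ω lam α f ≤ C ↔ ∀ x, expWeight ω lam x * ‖mderiv α f x‖ₑ ≤ C := by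
  simp only [s, wsup, iSup_le_iff, expWeight, mul_comm]

theorem expDecay_iff {f : Rn N → ℂ} (hf : f ∈ Smooth N) :
    ExpDecay ω f ↔ ∀ (lam : ℝ) (α : MultiIndex N), 0 < lam → s ω lam α f < ∞ := by
  refine ⟨fun h lam α _ => ?_, fun h => ⟨hf, fun n l => ?_⟩⟩
  · obtain ⟨l, -, hl⟩ := exists_dlist_eq_mderiv α
    obtain ⟨n, hn⟩ := exists_nat_ge lam
    obtain ⟨C, hC, hb⟩ := h.2 n.succPNat l
    refine (s_le_iff.2 fun x => ?_).trans_lt hC.lt_top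
    rw [hl]
    refine le_trans (mul_le_mul_left (expWeight_mono ?_ x) _) (hb x)
    rw [Nat.succPNat_coe, Nat.cast_succ]
    linarith
  · obtain ⟨α, -, hα⟩ := exists_mderiv_eq_dlist l
    refine ⟨s ω n α f, (h n α (by exact_mod_cast n.pos)).ne, fun x => ?_⟩
    rw [hα f hf]
    exact s_le_iff.1 le_rfl x

theorem mem_S_iff {f : Rn N → ℂ} :
    f ∈ S ω N ↔ ExpDecay ω f ∧ ExpDecay ω (fourier f) := by
  constructor
  · rintro ⟨-, h2, h3, h4⟩
    exact ⟨(expDecay_iff h2).2 fun lam α hl => (h4 lam α hl).1,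
      (expDecay_iff h3).2 fun lam α hl => (h4 lam α hl).2⟩
  · rintro ⟨h1, h2⟩
    exact ⟨h1.rapidDecay.integrable, h1.1, h2.1, fun lam α hl =>
      ⟨(expDecay_iff h1.1).1 h1 lam α hl, (expDecay_iff h2.1).1 h2 lam α hl⟩⟩

theorem coordMul_mem_S {f : Rn N → ℂ} (hf : f ∈ S ω N) (i : Fin N) : coordMul i f ∈ S ω N := by
  rw [mem_S_iff] at hf ⊢
  refine ⟨hf.1.coordMul i, ?_⟩
  have h : fourier (coordMul i f) = Complex.I • pderiv i (fourier f) := by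
    rw [hf.1.rapidDecay.pderiv_fourier, smul_smul]
    simp
  rw [h]
  exact (hf.2.pderiv i).smul _

/-- The bounds `(1 + ‖x‖) ^ L * |∂^α f(x)| ≤ A exp(m φ*(|α|/m))`. -/
def MomentBound (ω : Weight) (m : ℕ+) (L : ℕ) (A : ℝ≥0∞) (f : Rn N → ℂ) : Prop :=
  ∀ (l : List (Fin N)) (x : Rn N), (1 + ‖x‖ₑ) ^ L * ‖dlist l f x‖ₑ ≤ A * moment ω m l.length

/-- Smooth functions satisfying `MomentBound` for all parameters. -/
def MomentDecay (ω : Weight) (f : Rn N → ℂ) : Prop :=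
  f ∈ Smooth N ∧ ∀ (L : ℕ) (m : ℕ+), ∃ A : ℝ≥0∞, A ≠ ∞ ∧ MomentBound ω m L A f

/-- By Fourier inversion, exponential decay of the transform yields uniform bounds of the
derivatives by moments. -/
theorem exists_momentBound_zero_of_mem_S {f : Rn N → ℂ} (hf : f ∈ S ω N) (m : ℕ+) :
    ∃ A : ℝ≥0∞, A ≠ ∞ ∧ MomentBound ω m 0 A f := by
  rw [mem_S_iff] at hf
  obtain ⟨c, hc⟩ := exists_fourier_inversion N
  have hinv := hc f (continuous_of_mem_smooth hf.1.1) hf.1.rapidDecay.integrable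
    hf.2.rapidDecay.integrable
  set h : Rn N → ℂ := fun ξ => fourier f (-ξ) with hh
  have hhd : RapidDecay h := by
    refine ⟨hf.2.rapidDecay.1.comp continuous_neg, fun L => ?_⟩
    obtain ⟨A, hA, hb⟩ := hf.2.rapidDecay.2 L
    exact ⟨A, hA, fun x => by simpa using hb (-x)⟩
  obtain ⟨n, C₁, hC₁, h₁⟩ := exists_one_add_enorm_pow_le ω N (N + 1)
  obtain ⟨C₂, hC₂, h₂⟩ := hf.2.2 (n + m) []
  set E := ENNReal.ofReal (Real.exp (m * ω 1)) with hE
  refine ⟨‖c‖ₑ * (E * C₁ * C₂ * weightIntegral N), ENNReal.mul_ne_top (by simp)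
    (ENNReal.mul_ne_top (ENNReal.mul_ne_top (ENNReal.mul_ne_top ENNReal.ofReal_ne_top hC₁) hC₂)
      (weightIntegral_ne_top N)), fun l x => ?_⟩
  have h3 : dlist l f = c • (-Complex.I) ^ l.length • fourier (monomialMul l h) := by
    conv_lhs => rw [hinv]
    rw [dlist_smul l c hhd.fourier_mem_smooth, hhd.dlist_fourier]
  have h4 : ‖(-Complex.I) ^ l.length‖ₑ = 1 := by
    rw [← ofReal_norm]
    simp
  have h5 : ∀ ξ, (1 + ‖ξ‖ₑ) ^ (N + 1) * ‖monomialMul l h ξ‖ₑ ≤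
      E * C₁ * C₂ * moment ω m l.length := by
    intro ξ
    have h6 : ‖ξ‖ₑ ^ l.length ≤ E * expWeight ω m ξ * moment ω m l.length := by
      have := pow_le_moment ω (m := m) (by positivity) l.length (norm_nonneg ξ)
      rwa [ENNReal.ofReal_pow (norm_nonneg ξ), ofReal_norm, Real.exp_add,
        ENNReal.ofReal_mul (Real.exp_pos _).le] at this
    have h7 := h₂ (-ξ)
    have h8 : expWeight ω ((n + m : ℕ+) : ℝ) (-ξ) = expWeight ω n ξ * expWeight ω m ξ := by
      rw [PNat.add_coe, Nat.cast_add, expWeight_add, expWeight, expWeight, norm_neg]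
      rfl
    rw [h8, dlist_nil] at h7
    calc _ ≤ (C₁ * expWeight ω n ξ) *
          ((E * expWeight ω m ξ * moment ω m l.length) * ‖h ξ‖ₑ) := by
          refine mul_le_mul' (h₁ ξ) ((enorm_monomialMul_le l h ξ).trans ?_)
          gcongr
      _ = E * C₁ * (expWeight ω n ξ * expWeight ω m ξ * ‖h ξ‖ₑ) * moment ω m l.length := by ring
      _ ≤ _ := by gcongr
  rw [pow_zero, one_mul, h3, Pi.smul_apply, Pi.smul_apply, enorm_smul, enorm_smul, h4, one_mul]
  calc _ ≤ ‖c‖ₑ * (E * C₁ * C₂ * moment ω m l.length * weightIntegral N) := by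
        gcongr
        exact (enorm_fourier_le _ _).trans (lintegral_le_mul_weightIntegral h5)
    _ = _ := by ring

/-- Bounds by moments are stable under commutators with coordinates, at the cost of changing the
parameter `m`. -/
theorem exists_enorm_dlist_coordMul_sub_le (ω : Weight) (N : ℕ) (m : ℕ+) :
    ∃ (m' : ℕ+) (C : ℝ≥0∞), m ≤ m' ∧ C ≠ ∞ ∧
      ∀ {f : Rn N → ℂ} (_ : f ∈ Smooth N) {A w : ℝ≥0∞} {x : Rn N} (_ : w ≠ 0) (_ : w ≠ ∞)
        (_ : ∀ l : List (Fin N), w * ‖dlist l f x‖ₑ ≤ A * moment ω m' l.length)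
        (i : Fin N) (l : List (Fin N)),
        w * ‖dlist l (coordMul i f) x - (x i : ℂ) * dlist l f x‖ₑ ≤
          C * A * moment ω m l.length := by
  obtain ⟨m', C, hm, hC, h⟩ := exists_two_pow_mul_moment_le ω m
  refine ⟨m', C, hm, hC, fun {f} hf {A w x} hw hw' hA i l => ?_⟩
  have h1 := enorm_dlist_coordMul_sub_le i (x := x) (B := A * moment ω m' l.length / w) l hf
    fun l' hl' => by
      rw [ENNReal.le_div_iff_mul_le (Or.inl hw) (Or.inl hw'), mul_comm]
      refine (hA l').trans ?_
      gcongr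
      exact moment_mono (by omega)
  have h2 : (l.length : ℝ≥0∞) ≤ 2 ^ l.length := by
    exact_mod_cast (Nat.lt_two_pow_self (n := l.length)).le
  calc _ ≤ w * (l.length * (A * moment ω m' l.length / w)) := by gcongr
    _ = l.length * (w * (A * moment ω m' l.length / w)) := by ring
    _ = l.length * (A * moment ω m' l.length) := by rw [ENNReal.mul_div_cancel hw hw']
    _ ≤ 2 ^ l.length * (A * moment ω m' l.length) := by gcongr
    _ = A * (2 ^ l.length * moment ω m' l.length) := by ring
    _ ≤ A * (C * moment ω m l.length) := mul_le_mul_right (h _) _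
    _ = _ := by ring

/-- Elements of `S` satisfy mixed bounds: polynomial weights in `x` are produced one at a time by
multiplication with coordinates, under which `S` is stable. -/
theorem momentDecay_of_mem_S {f : Rn N → ℂ} (hf : f ∈ S ω N) : MomentDecay ω f := by
  refine ⟨(mem_S_iff.1 hf).1.1, fun L => ?_⟩
  induction L generalizing f with
  | zero => exact exists_momentBound_zero_of_mem_S hf
  | succ L ih =>
    intro m
    have hfs : f ∈ Smooth N := (mem_S_iff.1 hf).1.1
    obtain ⟨m', C, hm, hC, h⟩ := exists_enorm_dlist_coordMul_sub_le ω N m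
    obtain ⟨A, hA, hAb⟩ := ih hf m'
    choose B hB hBb using fun i => ih (coordMul_mem_S hf i) m
    refine ⟨A + ∑ i, (B i + C * A), ENNReal.add_ne_top.2 ⟨hA, (ENNReal.sum_lt_top.2
      fun i _ => (ENNReal.add_ne_top.2 ⟨hB i, ENNReal.mul_ne_top hC hA⟩).lt_top).ne⟩,
      fun l x => ?_⟩
    have hw := one_add_enorm_pow_ne_zero x L
    have hw' := one_add_enorm_pow_ne_top x L
    have h1 : ∀ i, (1 + ‖x‖ₑ) ^ L * (‖x i‖ₑ * ‖dlist l f x‖ₑ) ≤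
        (B i + C * A) * moment ω m l.length := by
      intro i
      have h2 := h hfs hw hw' (fun l => hAb l x) i l
      have h3 := hBb i l x
      have h4 : ‖x i‖ₑ * ‖dlist l f x‖ₑ ≤ ‖dlist l (coordMul i f) x‖ₑ +
          ‖dlist l (coordMul i f) x - (x i : ℂ) * dlist l f x‖ₑ := by
        have h5 : ‖x i‖ₑ = ‖((x i : ℝ) : ℂ)‖ₑ := by
          rw [← ofReal_norm, ← ofReal_norm, Complex.norm_real]
        rw [h5, ← enorm_mul, ← enorm_neg (_ - _), neg_sub]
        exact enorm_le_add_enorm_sub _ _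
      calc _ ≤ (1 + ‖x‖ₑ) ^ L * (‖dlist l (coordMul i f) x‖ₑ +
            ‖dlist l (coordMul i f) x - (x i : ℂ) * dlist l f x‖ₑ) := by gcongr
        _ ≤ _ := by
          rw [mul_add, add_mul]
          exact add_le_add h3 h2
    have h6 : (1 + ‖x‖ₑ) ^ L * ‖dlist l f x‖ₑ ≤ A * moment ω m l.length :=
      (hAb l x).trans (mul_le_mul_right (moment_anti (by exact_mod_cast hm) _) _)
    calc _ = (1 + ‖x‖ₑ) ^ L * ‖dlist l f x‖ₑ +
          (1 + ‖x‖ₑ) ^ L * (‖x‖ₑ * ‖dlist l f x‖ₑ) := by ring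
      _ ≤ (1 + ‖x‖ₑ) ^ L * ‖dlist l f x‖ₑ +
          (1 + ‖x‖ₑ) ^ L * ((∑ i, ‖x i‖ₑ) * ‖dlist l f x‖ₑ) := by
          gcongr
          exact enorm_le_sum x
      _ = (1 + ‖x‖ₑ) ^ L * ‖dlist l f x‖ₑ +
          ∑ i, (1 + ‖x‖ₑ) ^ L * (‖x i‖ₑ * ‖dlist l f x‖ₑ) := by
          rw [Finset.sum_mul, Finset.mul_sum]
      _ ≤ A * moment ω m l.length + ∑ i, (B i + C * A) * moment ω m l.length :=
          add_le_add h6 (Finset.sum_le_sum fun i _ => h1 i)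
      _ = _ := by rw [add_mul, Finset.sum_mul]

theorem exists_momentBound_coordMul (ω : Weight) (N L : ℕ) (m : ℕ+) :
    ∃ (m' : ℕ+) (C : ℝ≥0∞), C ≠ ∞ ∧ ∀ {f : Rn N → ℂ} (_ : f ∈ Smooth N) {A : ℝ≥0∞}
      (_ : MomentBound ω m' (L + 1) A f) (i : Fin N), MomentBound ω m L (C * A) (coordMul i f) := by
  obtain ⟨m', C, hm, hC, h⟩ := exists_enorm_dlist_coordMul_sub_le ω N m
  refine ⟨m', 1 + C, by simpa using hC, fun {f} hf {A} hA i l x => ?_⟩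
  have hle : (1 + ‖x‖ₑ) ^ L ≤ (1 + ‖x‖ₑ) ^ (L + 1) := pow_le_pow_right₀ (by simp) (Nat.le_succ L)
  have h1 := h hf (one_add_enorm_pow_ne_zero x L) (one_add_enorm_pow_ne_top x L)
    (fun l => (mul_le_mul_left hle _).trans (hA l x)) i l
  have h2 : (1 + ‖x‖ₑ) ^ L * ‖(x i : ℂ) * dlist l f x‖ₑ ≤ A * moment ω m l.length := by
    have h3 : ‖((x i : ℝ) : ℂ)‖ₑ ≤ 1 + ‖x‖ₑ :=
      (le_trans (enorm_le_iff_norm_le.2 (by simp)) (enorm_coord_le x i)).trans le_add_self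
    rw [enorm_mul, ← mul_assoc]
    calc _ ≤ (1 + ‖x‖ₑ) ^ L * (1 + ‖x‖ₑ) * ‖dlist l f x‖ₑ := by gcongr
      _ ≤ A * moment ω m' l.length := by rw [← pow_succ]; exact hA l x
      _ ≤ _ := mul_le_mul_right (moment_anti (by exact_mod_cast hm) _) _
  calc _ ≤ (1 + ‖x‖ₑ) ^ L * (‖(x i : ℂ) * dlist l f x‖ₑ +
        ‖dlist l (coordMul i f) x - (x i : ℂ) * dlist l f x‖ₑ) := by
        gcongr
        exact enorm_le_add_enorm_sub _ _
    _ ≤ A * moment ω m l.length + C * A * moment ω m l.length := by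
        rw [mul_add]
        exact add_le_add h2 h1
    _ = _ := by ring

theorem monomialMul_mem_smooth (w : List (Fin N)) {f : Rn N → ℂ} (hf : f ∈ Smooth N) :
    monomialMul w f ∈ Smooth N := by
  induction w with
  | nil => exact hf
  | cons i w ih => exact coordMul_mem_smooth i ih

theorem exists_momentBound_monomialMul (ω : Weight) (w : List (Fin N)) : ∀ (L : ℕ) (m : ℕ+),
    ∃ (L' : ℕ) (m' : ℕ+) (C : ℝ≥0∞), C ≠ ∞ ∧ ∀ {f : Rn N → ℂ} (_ : f ∈ Smooth N) {A : ℝ≥0∞}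
      (_ : MomentBound ω m' L' A f), MomentBound ω m L (C * A) (monomialMul w f) := by
  induction w with
  | nil =>
    exact fun L m => ⟨L, m, 1, by simp, fun {f} _ {A} hA => by simpa [monomialMul] using hA⟩
  | cons i w ih =>
    intro L m
    obtain ⟨m₁, C₁, hC₁, h₁⟩ := exists_momentBound_coordMul ω N L m
    obtain ⟨L', m', C, hC, h⟩ := ih (L + 1) m₁
    refine ⟨L', m', C₁ * C, ENNReal.mul_ne_top hC₁ hC, fun {f} hf {A} hA => ?_⟩
    rw [monomialMul_cons, mul_assoc]
    exact h₁ (monomialMul_mem_smooth w hf) (h hf hA) i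

theorem MomentDecay.monomialMul {f : Rn N → ℂ} (hf : MomentDecay ω f) (w : List (Fin N)) :
    MomentDecay ω (monomialMul w f) :=
  ⟨monomialMul_mem_smooth w hf.1, fun L m => by
    obtain ⟨L', m', C, hC, h⟩ := exists_momentBound_monomialMul ω w L m
    obtain ⟨A, hA, hAb⟩ := hf.2 L' m'
    exact ⟨C * A, ENNReal.mul_ne_top hC hA, h hf.1 hAb⟩⟩

theorem MomentDecay.rapidDecay_dlist {f : Rn N → ℂ} (hf : MomentDecay ω f) (l : List (Fin N)) :
    RapidDecay (dlist l f) := by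
  refine ⟨continuous_of_mem_smooth (dlist_mem l hf.1), fun L => ?_⟩
  obtain ⟨m, hm⟩ := exists_moment_lt_top ω l.length
  obtain ⟨A, hA, h⟩ := hf.2 L m
  exact ⟨_, ENNReal.mul_ne_top hA hm.ne, h l⟩

theorem MomentDecay.fourier_dlist_replicate {f : Rn N → ℂ} (hf : MomentDecay ω f) (i : Fin N)
    (k : ℕ) (ξ : Rn N) :
    fourier (dlist (List.replicate k i) f) ξ = (Complex.I * ξ i) ^ k * fourier f ξ := by
  induction k with
  | zero => simp
  | succ k ih =>
    rw [List.replicate_succ, dlist_cons, RapidDecay.fourier_pderiv (dlist_mem _ hf.1)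
      (hf.rapidDecay_dlist _) i (hf.rapidDecay_dlist (i :: List.replicate k i)), ih]
    ring

/-- Bounds of the derivatives by moments give exponential decay of the Fourier transform. The
number of derivatives to be used at `ξ` is supplied by `exists_moment_le`. -/
theorem exists_expWeight_mul_fourier_le (ω : Weight) (N : ℕ) (n : ℕ+) :
    ∃ (m : ℕ+) (C : ℝ≥0∞), C ≠ ∞ ∧ ∀ {g : Rn N → ℂ} (_ : MomentDecay ω g) {A : ℝ≥0∞}
      (_ : MomentBound ω m (N + 1) A g) (ξ : Rn N),
      expWeight ω n ξ * ‖fourier g ξ‖ₑ ≤ C * A := by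
  obtain ⟨K, hK, hKb⟩ := ω.exists_mul_le N
  obtain ⟨l, C₁, hC₁, h₁⟩ := ω.exists_pow_le 1
  obtain ⟨m, hm⟩ : ∃ m : ℕ+, n * K + l ≤ (m : ℝ) := by
    obtain ⟨m, hm⟩ := exists_nat_ge (n * K + l : ℝ)
    exact ⟨m.succPNat, hm.trans (by simp)⟩
  have hn0 : (0 : ℝ) < n := by exact_mod_cast n.pos
  set D : ℝ := C₁ * Real.exp (n * K) + Real.exp (n * ω N) with hD
  refine ⟨m, ENNReal.ofReal D * weightIntegral N, ENNReal.mul_ne_top ENNReal.ofReal_ne_top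
    (weightIntegral_ne_top N), fun {g} hg {A} hA ξ => ?_⟩
  have hl : ∀ l, ‖fourier (dlist l g) ξ‖ₑ ≤ A * moment ω m l.length * weightIntegral N :=
    fun l => (enorm_fourier_le _ _).trans (lintegral_le_mul_weightIntegral (hA l))
  by_cases hξ : ∀ i, |ξ i| ≤ 1
  · have h2 : ‖ξ‖ ≤ N := by simpa using norm_le_of_forall_abs_le hξ
    have h3 : expWeight ω n ξ ≤ ENNReal.ofReal D := by
      have := ω.mono (norm_nonneg ξ) h2
      refine ENNReal.ofReal_le_ofReal (le_trans (Real.exp_le_exp.2 ?_)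
        (le_add_of_nonneg_left (by positivity)))
      gcongr
    have h4 : ‖fourier g ξ‖ₑ ≤ A * 1 * weightIntegral N := by
      refine (hl []).trans ?_
      gcongr
      exact moment_zero_le (by positivity)
    calc _ ≤ ENNReal.ofReal D * (A * 1 * weightIntegral N) := by gcongr
      _ = _ := by ring
  · push Not at hξ
    obtain ⟨j, hj⟩ := hξ
    have : Nonempty (Fin N) := ⟨j⟩
    obtain ⟨i, hi⟩ := Finite.exists_max fun i => |ξ i|
    have hi1 : 1 < |ξ i| := hj.trans_le (hi j)
    have hi0 : 0 < |ξ i| := by linarith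
    set t := Real.log |ξ i| with ht
    have het : Real.exp t = |ξ i| := Real.exp_log hi0
    obtain ⟨k, hk⟩ := exists_moment_le ω (m := m) (by positivity) (t := t)
      (Real.log_nonneg hi1.le)
    have h2 := hl (List.replicate k i)
    have h3 : ‖(Complex.I * ξ i) ^ k‖ₑ = ENNReal.ofReal (Real.exp (k * t)) := by
      rw [← ofReal_norm, norm_pow, norm_mul, Complex.norm_I, one_mul, Complex.norm_real,
        Real.norm_eq_abs, mul_comm, Real.exp_mul, het, Real.rpow_natCast]
    rw [hg.fourier_dlist_replicate, List.length_replicate, enorm_mul, h3] at h2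
    have h4 : expWeight ω n ξ =
        ENNReal.ofReal (Real.exp (n * ω ‖ξ‖ - k * t)) * ENNReal.ofReal (Real.exp (k * t)) := by
      rw [← ENNReal.ofReal_mul (Real.exp_pos _).le, ← Real.exp_add, sub_add_cancel, expWeight]
    have h5 : n * ω ‖ξ‖ ≤ n * (K * (1 + ω |ξ i|)) := by
      gcongr
      exact (ω.mono (norm_nonneg _) (norm_le_of_forall_abs_le hi)).trans (hKb _ hi0.le)
    have h6 := ω.nonneg _ hi0.le
    have h7 : Real.exp (n * ω ‖ξ‖ - k * t) * Real.exp (k * t + t - m * ω (Real.exp t)) ≤ D := by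
      rw [← Real.exp_add, het, show n * ω ‖ξ‖ - k * t + (k * t + t - m * ω |ξ i|) =
        t + (n * ω ‖ξ‖ - m * ω |ξ i|) by ring, Real.exp_add, het]
      have h8 := h₁ _ hi0.le
      rw [pow_one] at h8
      calc _ ≤ C₁ * Real.exp (l * ω |ξ i|) * Real.exp (n * ω ‖ξ‖ - m * ω |ξ i|) := by
            gcongr
            linarith
        _ = C₁ * Real.exp (l * ω |ξ i| + (n * ω ‖ξ‖ - m * ω |ξ i|)) := by
            rw [Real.exp_add, mul_assoc]
        _ ≤ C₁ * Real.exp (n * K) := by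
            gcongr
            nlinarith [mul_le_mul_of_nonneg_right hm h6]
        _ ≤ D := le_add_of_nonneg_right (Real.exp_pos _).le
    calc _ = ENNReal.ofReal (Real.exp (n * ω ‖ξ‖ - k * t)) *
          (ENNReal.ofReal (Real.exp (k * t)) * ‖fourier g ξ‖ₑ) := by rw [h4, mul_assoc]
      _ ≤ ENNReal.ofReal (Real.exp (n * ω ‖ξ‖ - k * t)) * (A *
          ENNReal.ofReal (Real.exp (k * t + t - m * ω (Real.exp t))) * weightIntegral N) := by
          refine mul_le_mul_right (h2.trans ?_) _
          gcongr
      _ = ENNReal.ofReal (Real.exp (n * ω ‖ξ‖ - k * t) *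
          Real.exp (k * t + t - m * ω (Real.exp t))) * weightIntegral N * A := by
          rw [ENNReal.ofReal_mul (Real.exp_pos _).le]
          ring
      _ ≤ _ := by gcongr

theorem exists_expWeight_mul_dlist_fourier_le (ω : Weight) (n : ℕ+) (w : List (Fin N)) :
    ∃ (L : ℕ) (m : ℕ+) (C : ℝ≥0∞), C ≠ ∞ ∧ ∀ {g : Rn N → ℂ} (_ : MomentDecay ω g) {A : ℝ≥0∞}
      (_ : MomentBound ω m L A g) (ξ : Rn N),
      expWeight ω n ξ * ‖dlist w (fourier g) ξ‖ₑ ≤ C * A := by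
  obtain ⟨m₁, C₁, hC₁, h₁⟩ := exists_expWeight_mul_fourier_le ω N n
  obtain ⟨L, m, C, hC, h⟩ := exists_momentBound_monomialMul ω w (N + 1) m₁
  refine ⟨L, m, C₁ * C, ENNReal.mul_ne_top hC₁ hC, fun {g} hg {A} hA ξ => ?_⟩
  have h2 : ‖(-Complex.I) ^ w.length‖ₑ = 1 := by
    rw [← ofReal_norm]
    simp
  rw [RapidDecay.dlist_fourier (f := g) (hg.rapidDecay_dlist []), Pi.smul_apply, enorm_smul, h2, one_mul, mul_assoc]
  exact h₁ (hg.monomialMul w) (h hg.1 hA) ξ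

theorem MomentDecay.expDecay_fourier {f : Rn N → ℂ} (hf : MomentDecay ω f) :
    ExpDecay ω (fourier f) := by
  refine ⟨(hf.rapidDecay_dlist []).fourier_mem_smooth, fun n l => ?_⟩
  obtain ⟨L, m, C, hC, h⟩ := exists_expWeight_mul_dlist_fourier_le ω n l
  obtain ⟨A, hA, hAb⟩ := hf.2 L m
  exact ⟨C * A, ENNReal.mul_ne_top hC hA, h hf hAb⟩

end decay

/-! ### The inclusions -/

section inclusions

variable {N : ℕ} {ω : Weight}

theorem expWeight_neg_mul (c : ℝ) (x : Rn N) : expWeight ω (-c) x * expWeight ω c x = 1 := by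
  rw [← expWeight_add]
  simp [expWeight]

theorem expWeight_ne_zero (c : ℝ) (x : Rn N) : expWeight ω c x ≠ 0 :=
  (ENNReal.ofReal_pos.2 (Real.exp_pos _)).ne'

/-- The summand `1` makes the bound hold for infinite `M`, whose inverse is `0`. -/
theorem le_mul_of_mul_inv_le {u M C : ℝ≥0∞} (hM : M ≠ 0) (h : u * M⁻¹ ≤ C) :
    u ≤ (C + 1) * M := by
  by_cases hM' : M = ∞
  · rw [hM', ENNReal.mul_top (by simp)]
    exact le_top
  · calc u = u * M⁻¹ * M := by rw [mul_assoc, ENNReal.inv_mul_cancel hM hM', mul_one]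
      _ ≤ (C + 1) * M := by
        gcongr
        exact h.trans le_self_add

theorem mul_inv_le_of_le_mul {u M C : ℝ≥0∞} (h : u ≤ C * M) : u * M⁻¹ ≤ C :=
  ENNReal.div_le_of_le_mul h

theorem r_le {f : Rn N → ℂ} (hf : f ∈ Smooth N) {m : ℕ+} {n : ℤ} {A : ℝ≥0∞}
    (h : ∀ (l : List (Fin N)) x, ‖dlist l f x‖ₑ ≤ A * expWeight ω n x * moment ω m l.length) :
    r ω m n f ≤ A := by
  refine iSup_le fun q => ?_
  have h1 := (forall_dlist_iff hf q.2 fun k => A * expWeight ω n q.2 * moment ω m k).1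
    (fun l => h l q.2) q.1
  have h2 : rWeight ω N m n q = expWeight ω (-n) q.2 * (moment ω m q.1.order)⁻¹ := by
    rw [rWeight_eq, expWeight, neg_mul]
  rw [h2, ← mul_assoc]
  refine mul_inv_le_of_le_mul ?_
  calc _ ≤ A * expWeight ω n q.2 * moment ω m q.1.order * expWeight ω (-n) q.2 := by gcongr
    _ = A * moment ω m q.1.order * (expWeight ω (-n) q.2 * expWeight ω n q.2) := by ring
    _ = _ := by rw [expWeight_neg_mul, mul_one]

theorem exists_bound_of_mem_O {f : Rn N → ℂ} {m : ℕ+} {n : ℤ} (hf : f ∈ O ω N m n) :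
    ∃ A : ℝ≥0∞, A ≠ ∞ ∧ ∀ (l : List (Fin N)) x,
      ‖dlist l f x‖ₑ ≤ A * expWeight ω n x * moment ω m l.length := by
  refine ⟨r ω m n f + 1, ENNReal.add_ne_top.2 ⟨hf.2.ne, by simp⟩, fun l x => ?_⟩
  refine (forall_dlist_iff hf.1 x fun k =>
    (r ω m n f + 1) * expWeight ω n x * moment ω m k).2 (fun α => ?_) l
  have h1 : ‖mderiv α f x‖ₑ * rWeight ω N m n (α, x) ≤ r ω m n f :=
    le_iSup (fun q : MultiIndex N × Rn N => ‖mderiv q.1 f q.2‖ₑ * rWeight ω N m n q) (α, x)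
  have h2 : rWeight ω N m n (α, x) = expWeight ω (-n) x * (moment ω m α.order)⁻¹ := by
    rw [rWeight_eq, expWeight, neg_mul]
  rw [h2, ← mul_assoc] at h1
  have h3 := le_mul_of_mul_inv_le (moment_ne_zero _) h1
  calc ‖mderiv α f x‖ₑ = ‖mderiv α f x‖ₑ * expWeight ω (-n) x * expWeight ω n x := by
        rw [mul_assoc, expWeight_neg_mul, mul_one]
    _ ≤ (r ω m n f + 1) * moment ω m α.order * expWeight ω n x := by gcongr
    _ = _ := by ring

theorem mem_O_iff {f : Rn N → ℂ} {m : ℕ+} {n : ℤ} :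
    f ∈ O ω N m n ↔ f ∈ Smooth N ∧ ∃ A : ℝ≥0∞, A ≠ ∞ ∧ ∀ (l : List (Fin N)) x,
      ‖dlist l f x‖ₑ ≤ A * expWeight ω n x * moment ω m l.length :=
  ⟨fun hf => ⟨hf.1, exists_bound_of_mem_O hf⟩, fun ⟨hf, _, hA, h⟩ =>
    ⟨hf, (r_le hf h).trans_lt hA.lt_top⟩⟩

theorem mem_E_iff {f : Rn N → ℂ} :
    f ∈ E ω N ↔ f ∈ Smooth N ∧ ∀ (K : Set (Rn N)) (_ : IsCompact K) (m : ℕ+), ∃ A : ℝ≥0∞, A ≠ ∞ ∧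
      ∀ x ∈ K, ∀ l : List (Fin N), ‖dlist l f x‖ₑ ≤ A * moment ω m l.length := by
  refine ⟨fun hf => ⟨hf.1, fun K hK m => ?_⟩, fun ⟨hf, h⟩ => ⟨hf, fun K m => ?_⟩⟩
  · set K' : TopologicalSpace.Compacts (Rn N) := ⟨K, hK⟩
    refine ⟨p ω K' m f + 1, ENNReal.add_ne_top.2 ⟨(hf.2 K' m).ne, by simp⟩, fun x hx l => ?_⟩
    refine (forall_dlist_iff hf.1 x fun k => (p ω K' m f + 1) * moment ω m k).2 (fun α => ?_) l
    have h1 : ‖mderiv α f x‖ₑ * pWeight ω K' m (α, ⟨x, hx⟩) ≤ p ω K' m f :=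
      le_iSup (fun q : MultiIndex N × K' => ‖mderiv q.1 f q.2‖ₑ * pWeight ω K' m q)
        (α, ⟨x, hx⟩)
    rw [pWeight_eq] at h1
    exact le_mul_of_mul_inv_le (moment_ne_zero _) h1
  · obtain ⟨A, hA, hb⟩ := h K K.isCompact m
    refine (iSup_le fun q => ?_ : p ω K m f ≤ A).trans_lt hA.lt_top
    rw [pWeight_eq]
    exact mul_inv_le_of_le_mul ((forall_dlist_iff hf q.2 fun k => A * moment ω m k).1
      (fun l => hb q.2 q.2.2 l) q.1)

theorem MomentDecay.mem_OInter_one {f : Rn N → ℂ} (hf : MomentDecay ω f) : f ∈ OInter ω N 1 := by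
  refine (Submodule.mem_iInf _).2 fun m => mem_O_iff.2 ⟨hf.1, ?_⟩
  obtain ⟨A, hA, h⟩ := hf.2 0 m
  refine ⟨A, hA, fun l x => ?_⟩
  have h1 := h l x
  rw [pow_zero, one_mul] at h1
  refine h1.trans (mul_le_mul_left ?_ _)
  exact le_mul_of_one_le_right' (one_le_expWeight (by simp) x)

theorem S_le_OInter_one (ω : Weight) (N : ℕ) : S ω N ≤ OInter ω N 1 :=
  fun _ hf => (momentDecay_of_mem_S hf).mem_OInter_one

theorem S_le_OC (ω : Weight) (N : ℕ) : S ω N ≤ OC ω N :=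
  (S_le_OInter_one ω N).trans (OInter_le_OC ω N 1)

theorem OC_le_OM (ω : Weight) (N : ℕ) : OC ω N ≤ OM ω N := by
  intro f hf
  obtain ⟨n, hn⟩ := Set.mem_iUnion.1 hf
  exact (Submodule.mem_iInf _).2 fun m => O_le_OUnion ω N m n (OInter_le ω N n m hn)

theorem OM_le_E (ω : Weight) (N : ℕ) : OM ω N ≤ E ω N := by
  intro f hf
  have h : ∀ m : ℕ+, ∃ n : ℕ+, f ∈ O ω N m n := fun m => Set.mem_iUnion.1 (OM_le ω N m hf)
  refine mem_E_iff.2 ⟨(h 1).choose_spec.1, fun K hK m => ?_⟩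
  obtain ⟨n, hn⟩ := h m
  obtain ⟨A, hA, hb⟩ := exists_bound_of_mem_O hn
  obtain ⟨R, hR⟩ := hK.isBounded.exists_norm_le
  refine ⟨A * ENNReal.ofReal (Real.exp (n * ω R)), ENNReal.mul_ne_top hA ENNReal.ofReal_ne_top,
    fun x hx l => (hb l x).trans ?_⟩
  have := ω.mono (norm_nonneg x) (hR x hx)
  rw [expWeight, Int.cast_natCast]
  gcongr

theorem dlist_eq_zero_of_notMem_tsupport {f : Rn N → ℂ} {x : Rn N} (hx : x ∉ tsupport f)
    (l : List (Fin N)) : dlist l f x = 0 :=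
  dlist_eq_zero_of_eventuallyEq (notMem_tsupport_iff_eventuallyEq.1 hx) l

theorem momentDecay_of_mem_D {f : Rn N → ℂ} (hf : f ∈ D ω N) : MomentDecay ω f := by
  refine ⟨hf.1.1, fun L m => ?_⟩
  obtain ⟨A, hA, h⟩ := (mem_E_iff.1 hf.1).2 (tsupport f) hf.2.isCompact m
  obtain ⟨R, hR⟩ := hf.2.isCompact.isBounded.exists_norm_le
  refine ⟨ENNReal.ofReal (1 + R) ^ L * A,
    ENNReal.mul_ne_top (ENNReal.pow_ne_top ENNReal.ofReal_ne_top) hA, fun l x => ?_⟩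
  by_cases hx : x ∈ tsupport f
  · rw [one_add_enorm_eq, mul_assoc]
    have := hR x hx
    refine mul_le_mul' ?_ (h x hx l)
    gcongr
  · simp [dlist_eq_zero_of_notMem_tsupport hx]

theorem expDecay_of_mem_D {f : Rn N → ℂ} (hf : f ∈ D ω N) : ExpDecay ω f := by
  refine ⟨hf.1.1, fun n l => ?_⟩
  have hcs : HasCompactSupport (dlist l f) :=
    HasCompactSupport.intro hf.2.isCompact fun x hx => dlist_eq_zero_of_notMem_tsupport hx l
  obtain ⟨C, hC⟩ := hcs.exists_bound_of_continuous (continuous_of_mem_smooth (dlist_mem l hf.1.1))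
  obtain ⟨R, hR⟩ := hf.2.isCompact.isBounded.exists_norm_le
  refine ⟨ENNReal.ofReal (Real.exp (n * ω R)) * ENNReal.ofReal C,
    ENNReal.mul_ne_top ENNReal.ofReal_ne_top ENNReal.ofReal_ne_top, fun x => ?_⟩
  by_cases hx : x ∈ tsupport f
  · have := ω.mono (norm_nonneg x) (hR x hx)
    rw [expWeight, ← ofReal_norm]
    gcongr
    exact hC x
  · simp [dlist_eq_zero_of_notMem_tsupport hx]

theorem D_le_S (ω : Weight) (N : ℕ) : D ω N ≤ S ω N := fun _ hf =>
  mem_S_iff.2 ⟨expDecay_of_mem_D hf, (momentDecay_of_mem_D hf).expDecay_fourier⟩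

end inclusions

/-! ### Approximation by cutoffs -/

section approximation

variable {N : ℕ} {ω : Weight}

variable {χ : ℕ → Rn N → ℂ}

theorem IsCutoff.tail_mem (hχ : IsCutoff ω χ) (j : ℕ) : 1 - χ j ∈ Smooth N :=
  sub_mem one_mem_smooth (hχ.smooth j)

theorem IsCutoff.tail_bound (hχ : IsCutoff ω χ) (m : ℕ+) :
    ∃ C : ℝ≥0∞, C ≠ ∞ ∧ ∀ j l x, ‖dlist l (1 - χ j) x‖ₑ ≤ C * moment ω m l.length := by
  obtain ⟨C, hC, h⟩ := hχ.bound m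
  obtain ⟨C', hC', h'⟩ := exists_enorm_dlist_one_le ω N m
  refine ⟨C' + C, ENNReal.add_ne_top.2 ⟨hC', hC⟩, fun j l x => ?_⟩
  have h1 : (1 : Rn N → ℂ) - χ j = 1 + (-1 : ℂ) • χ j := by
    simp [sub_eq_add_neg]
  rw [h1, dlist_add l one_mem_smooth (Submodule.smul_mem _ _ (hχ.smooth j)),
    dlist_smul l _ (hχ.smooth j), Pi.add_apply, Pi.smul_apply, add_mul]
  refine (enorm_add_le _ _).trans (add_le_add (h' l x) ?_)
  rw [enorm_smul]
  simpa using h j l x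

theorem sub_cutoff_mul (χ f : Rn N → ℂ) : f - χ * f = (1 - χ) * f := by ring

theorem IsCutoff.sub_mul_mem_smooth (hχ : IsCutoff ω χ) {f : Rn N → ℂ} (hf : f ∈ Smooth N) (j : ℕ) :
    f - χ j * f ∈ Smooth N :=
  sub_cutoff_mul (χ j) f ▸ mul_mem_smooth (hχ.tail_mem j) hf

theorem IsCutoff.dlist_sub_eq_zero (hχ : IsCutoff ω χ) (f : Rn N → ℂ) {j : ℕ} {x : Rn N}
    (hx : ‖x‖ < j + 1) (l : List (Fin N)) : dlist l (f - χ j * f) x = 0 := by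
  refine dlist_eq_zero_of_eventuallyEq ?_ l
  filter_upwards [continuous_norm.continuousAt.eventually_lt_const hx] with y hy
  simp [hχ.eq_one j y hy]

theorem IsCutoff.exists_bound_sub (hχ : IsCutoff ω χ) (m : ℕ+) :
    ∃ (m' : ℕ+) (C : ℝ≥0∞), m ≤ m' ∧ C ≠ ∞ ∧ ∀ {f : Rn N → ℂ} (_ : f ∈ Smooth N) {A : ℝ≥0∞}
      {x : Rn N} (_ : ∀ l : List (Fin N), ‖dlist l f x‖ₑ ≤ A * moment ω m' l.length)
      (j : ℕ) (l : List (Fin N)), ‖dlist l (f - χ j * f) x‖ₑ ≤ C * A * moment ω m l.length := by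
  obtain ⟨m', C, hm, hC, h⟩ := exists_enorm_dlist_mul_le ω N m
  obtain ⟨C', hC', h'⟩ := hχ.tail_bound m'
  refine ⟨m', C * C', hm, ENNReal.mul_ne_top hC hC', fun {f} hf {A x} hA j l => ?_⟩
  rw [sub_cutoff_mul]
  exact h (hχ.tail_mem j) hf (fun l => h' j l x) hA l

theorem IsCutoff.mul_mem_D (hχ : IsCutoff ω χ) {f : Rn N → ℂ} (hf : f ∈ E ω N) (j : ℕ) :
    χ j * f ∈ D ω N := by
  rw [mem_E_iff] at hf
  refine ⟨mem_E_iff.2 ⟨mul_mem_smooth (hχ.smooth j) hf.1, fun K hK m => ?_⟩,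
    (hχ.hasCompactSupport j).mul_right⟩
  obtain ⟨m', C, -, hC, h⟩ := exists_enorm_dlist_mul_le ω N m
  obtain ⟨C', hC', h'⟩ := hχ.bound m'
  obtain ⟨A, hA, hAb⟩ := hf.2 K hK m'
  exact ⟨C * C' * A, ENNReal.mul_ne_top (ENNReal.mul_ne_top hC hC') hA, fun x hx l =>
    h (hχ.smooth j) hf.1 (fun l => h' j l x) (hAb x hx) l⟩

theorem tendsto_mul_ofReal_exp_neg (ω : Weight) {B : ℝ≥0∞} (hB : B ≠ ∞) :
    Tendsto (fun j : ℕ => B * ENNReal.ofReal (Real.exp (-ω (j + 1)))) atTop (𝓝 0) := by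
  have h1 : Tendsto (fun j : ℕ => ω ((j : ℝ) + 1)) atTop atTop :=
    ω.tendsto_atTop.comp (tendsto_atTop_add_const_right _ _ tendsto_natCast_atTop_atTop)
  have h2 := ENNReal.tendsto_ofReal (Real.tendsto_exp_neg_atTop_nhds_zero.comp h1)
  rw [ENNReal.ofReal_zero] at h2
  simpa using ENNReal.Tendsto.const_mul h2 (Or.inr hB)

theorem expWeight_neg_one_le {x : Rn N} {j : ℕ} (hx : (j : ℝ) + 1 ≤ ‖x‖) :
    expWeight ω (-1) x ≤ ENNReal.ofReal (Real.exp (-ω (j + 1))) := by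
  have := ω.mono (by positivity) hx
  rw [expWeight]
  gcongr
  linarith

/-- Outside the ball of radius `j + 1`, passing from the weight `exp(n ω)` to `exp((n + 1) ω)`
gains the factor `exp(-ω(j + 1))`. -/
theorem IsCutoff.exists_r_sub_le (hχ : IsCutoff ω χ) (m : ℕ+) :
    ∃ m' : ℕ+, m ≤ m' ∧ ∀ (n : ℤ) (f : Rn N → ℂ), f ∈ O ω N m' n → ∃ B : ℝ≥0∞, B ≠ ∞ ∧
      ∀ j : ℕ, r ω m (n + 1) (f - χ j * f) ≤ B * ENNReal.ofReal (Real.exp (-ω (j + 1))) := by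
  obtain ⟨m', C, hm, hC, h⟩ := hχ.exists_bound_sub m
  refine ⟨m', hm, fun n f hf => ?_⟩
  obtain ⟨A, hA, hb⟩ := exists_bound_of_mem_O hf
  refine ⟨C * A, ENNReal.mul_ne_top hC hA, fun j => r_le (hχ.sub_mul_mem_smooth hf.1 j) fun l x => ?_⟩
  rcases lt_or_ge ‖x‖ (j + 1) with hx | hx
  · simp [hχ.dlist_sub_eq_zero f hx l]
  · refine (h hf.1 (fun l => hb l x) j l).trans ?_
    have h1 : expWeight ω n x = expWeight ω (-1) x * expWeight ω ((n + 1 : ℤ) : ℝ) x := by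
      rw [← expWeight_add]
      congr 1
      push_cast
      ring
    rw [h1]
    calc _ = C * A * expWeight ω (-1) x * expWeight ω ((n + 1 : ℤ) : ℝ) x *
          moment ω m l.length := by ring
      _ ≤ _ := by
        gcongr
        exact expWeight_neg_one_le hx

/-- A Leibniz estimate up to a fixed order. It is obtained from `enorm_dlist_mul_le` for the
sequence that is `1` up to this order and `∞` beyond. -/
theorem enorm_dlist_mul_le_of_length_le {f g : Rn N → ℂ} (hf : f ∈ Smooth N) (hg : g ∈ Smooth N)
    {K : ℕ} {A B : ℝ≥0∞} (hA0 : A ≠ 0) (hB0 : B ≠ 0) {x : Rn N}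
    (hA : ∀ l : List (Fin N), l.length ≤ K → ‖dlist l f x‖ₑ ≤ A)
    (hB : ∀ l : List (Fin N), l.length ≤ K → ‖dlist l g x‖ₑ ≤ B)
    (l : List (Fin N)) (hl : l.length ≤ K) : ‖dlist l (f * g) x‖ₑ ≤ A * B * 2 ^ l.length := by
  set M : ℕ → ℝ≥0∞ := fun k => if k ≤ K then 1 else ∞ with hM
  have hMM : ∀ j k, M j * M k ≤ M (j + k) := by
    intro j k
    by_cases h : j + k ≤ K
    · simp [hM, h, (by omega : j ≤ K), (by omega : k ≤ K)]
    · simp [hM, h]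
  have hbd : ∀ {C : ℝ≥0∞} {h : Rn N → ℂ}, C ≠ 0 →
      (∀ l : List (Fin N), l.length ≤ K → ‖dlist l h x‖ₑ ≤ C) →
      ∀ l : List (Fin N), ‖dlist l h x‖ₑ ≤ C * M (0 + l.length) := by
    intro C h hC hb l
    by_cases hl : l.length ≤ K
    · simpa [hM, hl] using hb l hl
    · simp [hM, hl, ENNReal.mul_top hC]
  have h1 := enorm_dlist_mul_le hMM l hf hg 0 0 (hbd hA0 hA) (hbd hB0 hB)
  simpa [hM, hl] using h1

theorem ExpDecay.exists_bound_of_length_le {f : Rn N → ℂ} (hf : ExpDecay ω f) (n : ℕ+) (K : ℕ) :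
    ∃ C : ℝ≥0∞, C ≠ ∞ ∧ C ≠ 0 ∧ ∀ (l : List (Fin N)) (_ : l.length ≤ K) (x : Rn N),
      expWeight ω n x * ‖dlist l f x‖ₑ ≤ C := by
  choose C hC h using hf.2 n
  have hfin := List.finite_length_le (Fin N) K
  refine ⟨∑ l ∈ hfin.toFinset, C l + 1, ENNReal.add_ne_top.2
    ⟨(ENNReal.sum_lt_top.2 fun l _ => (hC l).lt_top).ne, by simp⟩, by simp, fun l hl x => ?_⟩
  refine (h l x).trans (le_trans ?_ le_self_add)
  exact Finset.single_le_sum (f := C) (fun _ _ => zero_le) (hfin.mem_toFinset.2 hl)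

theorem IsCutoff.exists_s_sub_le (hχ : IsCutoff ω χ) {f : Rn N → ℂ} (hf : ExpDecay ω f)
    (n : ℕ+) (α : MultiIndex N) : ∃ B : ℝ≥0∞, B ≠ ∞ ∧
      ∀ j : ℕ, s ω n α (f - χ j * f) ≤ B * ENNReal.ofReal (Real.exp (-ω (j + 1))) := by
  obtain ⟨l, -, hl⟩ := exists_dlist_eq_mderiv α
  set K := l.length with hK
  obtain ⟨C, hC, hC0, h⟩ := hf.exists_bound_of_length_le (n + 1) K
  obtain ⟨m, hm⟩ := exists_moment_lt_top ω K
  obtain ⟨C', hC', h'⟩ := hχ.tail_bound m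
  set B := C' * moment ω m K + 1 with hB
  have hBt : B ≠ ∞ := ENNReal.add_ne_top.2 ⟨ENNReal.mul_ne_top hC' hm.ne, by simp⟩
  refine ⟨B * C * 2 ^ K, ENNReal.mul_ne_top (ENNReal.mul_ne_top hBt hC)
    (ENNReal.pow_ne_top (by simp)), fun j => s_le_iff.2 fun x => ?_⟩
  rw [hl]
  rcases lt_or_ge ‖x‖ (j + 1) with hx | hx
  · simp [hχ.dlist_sub_eq_zero f hx l]
  · have h1 := enorm_dlist_mul_le_of_length_le (hχ.tail_mem j) hf.1 (K := K) (A := B)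
      (B := C * expWeight ω (-((n + 1 : ℕ+) : ℝ)) x) (x := x) (by simp [hB])
      (mul_ne_zero hC0 (expWeight_ne_zero _ _))
      (fun l' hl' => (h' j l' x).trans (le_trans (by gcongr; exact moment_mono hl') le_self_add))
      (fun l' hl' => by
        calc ‖dlist l' f x‖ₑ = expWeight ω ((n + 1 : ℕ+) : ℝ) x * ‖dlist l' f x‖ₑ *
              expWeight ω (-((n + 1 : ℕ+) : ℝ)) x := by
              rw [mul_right_comm, mul_comm (expWeight ω _ x), expWeight_neg_mul, one_mul]
          _ ≤ _ := by gcongr; exact h l' hl' x) l le_rfl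
    rw [sub_cutoff_mul]
    have h2 : expWeight ω n x * expWeight ω (-((n + 1 : ℕ+) : ℝ)) x = expWeight ω (-1) x := by
      rw [← expWeight_add]
      congr 1
      push_cast
      ring
    calc _ ≤ expWeight ω n x * (B * (C * expWeight ω (-((n + 1 : ℕ+) : ℝ)) x) * 2 ^ K) := by
          gcongr
      _ = B * C * 2 ^ K * (expWeight ω n x * expWeight ω (-((n + 1 : ℕ+) : ℝ)) x) := by ring
      _ ≤ _ := by
        rw [h2]
        gcongr
        exact expWeight_neg_one_le hx

theorem IsCutoff.exists_momentBound_sub (hχ : IsCutoff ω χ) {f : Rn N → ℂ} (hf : MomentDecay ω f)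
    (m : ℕ+) (L : ℕ) : ∃ B : ℝ≥0∞, B ≠ ∞ ∧
      ∀ j : ℕ, MomentBound ω m L (B * ((j : ℝ≥0∞) + 1)⁻¹) (f - χ j * f) := by
  obtain ⟨m', C, -, hC, h⟩ := hχ.exists_bound_sub m
  obtain ⟨A, hA, hb⟩ := hf.2 (L + 1) m'
  refine ⟨C * A, ENNReal.mul_ne_top hC hA, fun j l x => ?_⟩
  rcases lt_or_ge ‖x‖ (j + 1) with hx | hx
  · simp [hχ.dlist_sub_eq_zero f hx l]
  · have hw := one_add_enorm_pow_ne_zero x (L + 1)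
    have hw' := one_add_enorm_pow_ne_top x (L + 1)
    have h1 := h hf.1 (A := A * ((1 + ‖x‖ₑ) ^ (L + 1))⁻¹) (x := x) (fun l => by
      rw [mul_right_comm, ← div_eq_mul_inv, ENNReal.le_div_iff_mul_le (Or.inl hw) (Or.inl hw'),
        mul_comm]
      exact hb l x) j l
    have h2 : (1 + ‖x‖ₑ) ^ L * ((1 + ‖x‖ₑ) ^ (L + 1))⁻¹ = (1 + ‖x‖ₑ)⁻¹ := by
      rw [pow_succ, ENNReal.mul_inv (Or.inl (one_add_enorm_pow_ne_zero x L))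
        (Or.inl (one_add_enorm_pow_ne_top x L)), ← mul_assoc,
        ENNReal.mul_inv_cancel (one_add_enorm_pow_ne_zero x L) (one_add_enorm_pow_ne_top x L),
        one_mul]
    have h3 : (j : ℝ≥0∞) + 1 ≤ 1 + ‖x‖ₑ := by
      rw [one_add_enorm_eq, ← ENNReal.ofReal_natCast, ← ENNReal.ofReal_one,
        ← ENNReal.ofReal_add (by positivity) zero_le_one]
      refine ENNReal.ofReal_le_ofReal ?_
      linarith
    calc _ ≤ (1 + ‖x‖ₑ) ^ L * (C * (A * ((1 + ‖x‖ₑ) ^ (L + 1))⁻¹) * moment ω m l.length) := by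
          gcongr
      _ = C * A * ((1 + ‖x‖ₑ) ^ L * ((1 + ‖x‖ₑ) ^ (L + 1))⁻¹) * moment ω m l.length := by ring
      _ ≤ _ := by
        rw [h2]
        gcongr

end approximation

/-! ### Density -/

section density

variable {N : ℕ} {ω : Weight} {χ : ℕ → Rn N → ℂ}

theorem isDenseSubspace_of_tendsto {W V : Submodule ℂ (Rn N → ℂ)} {t : TopologicalSpace V}
    (hWV : W ≤ V) (h : ∀ f : V, ∃ u : ℕ → V, (∀ j, (u j : Rn N → ℂ) ∈ W) ∧
      Tendsto u atTop (@nhds V t f)) : IsDenseSubspace W V t := by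
  refine ⟨hWV, fun f => ?_⟩
  obtain ⟨u, hu, hut⟩ := h f
  exact mem_closure_of_tendsto hut (Eventually.of_forall hu)

theorem tendsto_nhds_seminormTopology {V ι : Type*} [AddCommGroup V] [Module ℂ V] [Nonempty ι]
    {p : SeminormFamily ℂ V ι} {u : ℕ → V} {f : V}
    (h : ∀ i, Tendsto (fun j => p i (f - u j)) atTop (𝓝 0)) :
    Tendsto u atTop (@nhds V (seminormTopology p) f) := by
  let _ := seminormTopology p
  have hp : WithSeminorms p := ⟨rfl⟩
  refine (hp.tendsto_nhds u f).2 fun i ε hε => ?_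
  filter_upwards [(h i).eventually_lt_const hε] with j hj
  rwa [map_sub_rev]

theorem tendsto_toReal_of_le {v δ : ℕ → ℝ≥0∞} (h : ∀ j, v j ≤ δ j)
    (hδ : Tendsto δ atTop (𝓝 0)) : Tendsto (fun j => (v j).toReal) atTop (𝓝 0) := by
  have h1 := tendsto_of_tendsto_of_tendsto_of_le_of_le tendsto_const_nhds hδ
    (fun _ => zero_le) h
  have h2 := (ENNReal.tendsto_toReal ENNReal.zero_ne_top).comp h1
  rwa [ENNReal.toReal_zero] at h2

theorem tendsto_inductiveTopology {X ι : Type*} [AddCommGroup X] [Module ℂ X] [Module ℝ X]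
    [IsScalarTower ℝ ℂ X] {V : Submodule ℂ X} {W : ι → Submodule ℂ X} {hW : ∀ i, W i ≤ V}
    {tW : ∀ i, TopologicalSpace (W i)} (i : ι) {u : ℕ → W i} {f : W i}
    (h : Tendsto u atTop (@nhds _ (tW i) f)) :
    Tendsto (fun j => Submodule.inclusion (hW i) (u j)) atTop
      (@nhds V (inductiveTopology V W hW tW) (Submodule.inclusion (hW i) f)) := by
  have hc : @Continuous (W i) V (tW i) (inductiveTopology V W hW tW)
      (Submodule.inclusion (hW i)) :=
    continuous_sInf_rng.2 fun t ht => ht.2.2.2 i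
  exact (@Continuous.tendsto _ _ (tW i) (inductiveTopology V W hW tW) _ hc f).comp h

theorem IsCutoff.isDenseSubspace_D_S (hχ : IsCutoff ω χ) :
    IsDenseSubspace (D ω N) (S ω N) (topS ω N) := by
  refine isDenseSubspace_of_tendsto (D_le_S ω N) fun f => ?_
  have hf := mem_S_iff.1 f.2
  have hfE : (f : Rn N → ℂ) ∈ E ω N := OM_le_E ω N (OC_le_OM ω N (S_le_OC ω N f.2))
  have hD := hχ.mul_mem_D hfE
  refine ⟨fun j => ⟨χ j * f, D_le_S ω N (hD j)⟩, hD, tendsto_nhds_seminormTopology ?_⟩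
  rintro ⟨n, α⟩
  rw [← add_zero (0 : ℝ)]
  refine Tendsto.add (f := fun j => (s ω n α ((f : Rn N → ℂ) - χ j * f)).toReal)
    (g := fun j => (s ω n α (fourier ((f : Rn N → ℂ) - χ j * f))).toReal) ?_ ?_
  · obtain ⟨B, hB, h⟩ := hχ.exists_s_sub_le hf.1 n α
    exact tendsto_toReal_of_le h (tendsto_mul_ofReal_exp_neg ω hB)
  · obtain ⟨l, -, hl⟩ := exists_dlist_eq_mderiv α
    obtain ⟨L, m, C, hC, h⟩ := exists_expWeight_mul_dlist_fourier_le ω n l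
    have hfM := momentDecay_of_mem_S f.2
    obtain ⟨B, hB, hb⟩ := hχ.exists_momentBound_sub hfM m L
    refine tendsto_toReal_of_le (δ := fun j : ℕ => C * (B * ((j : ℝ≥0∞) + 1)⁻¹))
      (fun j => s_le_iff.2 fun ξ => ?_) ?_
    · rw [hl]
      exact h (momentDecay_of_mem_S (sub_mem f.2 (D_le_S ω N (hD j)))) (hb j) ξ
    · have h1 : Tendsto (fun j : ℕ => ((j : ℝ≥0∞) + 1)⁻¹) atTop (𝓝 0) := by
        have := ENNReal.tendsto_inv_nat_nhds_zero.comp (tendsto_add_atTop_nat 1)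
        simpa [Function.comp_def] using this
      have h2 := ENNReal.Tendsto.const_mul (ENNReal.Tendsto.const_mul h1 (Or.inr hB))
        (Or.inr hC)
      simpa using h2

theorem IsCutoff.isDenseSubspace_S_OC (hχ : IsCutoff ω χ) :
    IsDenseSubspace (S ω N) (OC ω N) (topOC ω N) := by
  refine isDenseSubspace_of_tendsto (S_le_OC ω N) fun f => ?_
  have hfE : (f : Rn N → ℂ) ∈ E ω N := OM_le_E ω N (OC_le_OM ω N f.2)
  have hS : ∀ j, χ j * (f : Rn N → ℂ) ∈ S ω N := fun j => D_le_S ω N (hχ.mul_mem_D hfE j)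
  obtain ⟨n, hn⟩ := Set.mem_iUnion.1 f.2
  have hf1 : (f : Rn N → ℂ) ∈ OInter ω N ((n + 1 : ℕ+) : ℤ) :=
    OInter_mono ω N (by push_cast; linarith) hn
  have hu1 : ∀ j, χ j * (f : Rn N → ℂ) ∈ OInter ω N ((n + 1 : ℕ+) : ℤ) := fun j =>
    OInter_mono ω N (by push_cast; linarith [n.pos]) (S_le_OInter_one ω N (hS j))
  refine ⟨fun j => ⟨χ j * f, S_le_OC ω N (hS j)⟩, hS, ?_⟩
  refine tendsto_inductiveTopology (tW := fun n : ℕ+ => topOInter ω N n) (n + 1)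
    (u := fun j => ⟨χ j * f, hu1 j⟩) (f := ⟨f, hf1⟩) (tendsto_nhds_seminormTopology fun m => ?_)
  obtain ⟨m', -, h⟩ := hχ.exists_r_sub_le m
  obtain ⟨B, hB, hb⟩ := h n f (OInter_le ω N n m' hn)
  exact tendsto_toReal_of_le hb (tendsto_mul_ofReal_exp_neg ω hB)

theorem IsCutoff.isDenseSubspace_OC_OM (hχ : IsCutoff ω χ) :
    IsDenseSubspace (OC ω N) (OM ω N) (topOM ω N) := by
  refine isDenseSubspace_of_tendsto (OC_le_OM ω N) fun f => ?_
  have hS : ∀ j, χ j * (f : Rn N → ℂ) ∈ S ω N := fun j =>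
    D_le_S ω N (hχ.mul_mem_D (OM_le_E ω N f.2) j)
  refine ⟨fun j => ⟨χ j * f, OC_le_OM ω N (S_le_OC ω N (hS j))⟩, fun j => S_le_OC ω N (hS j), ?_⟩
  rw [nhds_iInf, tendsto_iInf]
  intro m
  rw [@nhds_induced _ _ (topOUnion ω N m), tendsto_comap_iff]
  obtain ⟨m', hm, h⟩ := hχ.exists_r_sub_le m
  obtain ⟨n, hn⟩ : ∃ n : ℕ+, (f : Rn N → ℂ) ∈ O ω N m' n :=
    Set.mem_iUnion.1 (OM_le ω N m' f.2)
  obtain ⟨B, hB, hb⟩ := h n f hn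
  have hf1 : (f : Rn N → ℂ) ∈ O ω N m ((n + 1 : ℕ+) : ℤ) := by
    refine O_mono ω N m (n := n) (by push_cast; linarith) ?_
    obtain ⟨A, hA, hAb⟩ := exists_bound_of_mem_O hn
    exact mem_O_iff.2 ⟨hn.1, A, hA, fun l x => (hAb l x).trans
      (mul_le_mul_right (moment_anti (by exact_mod_cast hm) _) _)⟩
  have hu1 : ∀ j, χ j * (f : Rn N → ℂ) ∈ O ω N m ((n + 1 : ℕ+) : ℤ) := fun j =>
    O_mono ω N m (by push_cast; linarith [n.pos]) (OInter_le ω N 1 m (S_le_OInter_one ω N (hS j)))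
  refine tendsto_inductiveTopology (tW := fun n : ℕ+ => topO ω N m n) (n + 1)
    (u := fun j => ⟨χ j * f, hu1 j⟩) (f := ⟨f, hf1⟩) (tendsto_nhds_seminormTopology fun _ => ?_)
  exact tendsto_toReal_of_le hb (tendsto_mul_ofReal_exp_neg ω hB)

theorem IsCutoff.isDenseSubspace_OM_E (hχ : IsCutoff ω χ) :
    IsDenseSubspace (OM ω N) (E ω N) (topE ω N) := by
  refine isDenseSubspace_of_tendsto (OM_le_E ω N) fun f => ?_
  have hD := hχ.mul_mem_D f.2
  refine ⟨fun j => ⟨χ j * f, (hD j).1⟩,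
    fun j => OC_le_OM ω N (S_le_OC ω N (D_le_S ω N (hD j))), tendsto_nhds_seminormTopology ?_⟩
  rintro ⟨K, m⟩
  obtain ⟨R, hR⟩ := K.isCompact.isBounded.exists_norm_le
  refine tendsto_const_nhds.congr' ?_
  filter_upwards [eventually_ge_atTop ⌈R⌉₊] with j hj
  have h1 : p ω K m ((f : Rn N → ℂ) - χ j * f) = 0 := by
    refine le_antisymm (iSup_le fun q => ?_) zero_le
    obtain ⟨l, -, hl⟩ := exists_dlist_eq_mderiv q.1
    have h2 : ‖(q.2 : Rn N)‖ < j + 1 := by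
      have h3 := hR q.2 q.2.2
      have h4 := Nat.le_ceil R
      have h5 : (⌈R⌉₊ : ℝ) ≤ j := by exact_mod_cast hj
      linarith
    change ‖mderiv q.1 ((f : Rn N → ℂ) - χ j * f) q.2‖ₑ * _ ≤ 0
    rw [hl, hχ.dlist_sub_eq_zero _ h2]
    simp
  change 0 = (p ω K m ((f : Rn N → ℂ) - χ j * f)).toReal
  rw [h1, ENNReal.toReal_zero]

end density

end BeurlingSpaces

theorem theorem3p8 (N : ℕ) (ω : BeurlingSpaces.Weight) :
    BeurlingSpaces.IsDenseSubspace (BeurlingSpaces.D ω N) (BeurlingSpaces.S ω N)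
      (BeurlingSpaces.topS ω N) ∧
    BeurlingSpaces.IsDenseSubspace (BeurlingSpaces.S ω N) (BeurlingSpaces.OC ω N)
      (BeurlingSpaces.topOC ω N) ∧
    BeurlingSpaces.IsDenseSubspace (BeurlingSpaces.OC ω N) (BeurlingSpaces.OM ω N)
      (BeurlingSpaces.topOM ω N) ∧
    BeurlingSpaces.IsDenseSubspace (BeurlingSpaces.OM ω N) (BeurlingSpaces.E ω N)
      (BeurlingSpaces.topE ω N) := by
  obtain ⟨χ, hχ⟩ := BeurlingSpaces.exists_isCutoff ω N
  exact ⟨hχ.isDenseSubspace_D_S, hχ.isDenseSubspace_S_OC, hχ.isDenseSubspace_OC_OM,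
    hχ.isDenseSubspace_OM_E⟩
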